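/- Let $m\ge 0$ be an integer, $g>1$, $\alpha>0$. Functions of $r=|x|$ on $\mathbb R^2$ are identified with their profiles on $(0,\infty)$; $L^p$ norms are those of $L^p(\mathbb R^2)$ (i.e. with respect to $2\pi r\,dr$), and $\langle f,h\rangle=\mathrm{Re}\int f\bar h\,dx$. For a real profile $Q$ put $$A_\theta[Q](r)=-\tfrac12\int_0^r Q^2 s\,ds,\qquad A_0[Q](r)=-\int_r^\infty (m+A_\theta[Q](s))\,Q(s)^2\,\frac{ds}{s}.$$ Let $Q>0$ be a standing wave profile: $Q$ is $C^2$ on $(0,\infty)$, $Q(r)e^{im\theta}\in H^1(\mathbb R^2)$, and $$Q''+\tfrac1r Q'-\tfrac{m^2}{r^2}Q-\tfrac{2m}{r^2}A_\theta[Q]Q-A_0[Q]Q-\tfrac1{r^2}A_\theta[Q]^2Q+gQ^3-\alpha Q=0 .$$ Let $\Lambda Q=Q+x\cdot\nabla Q=Q+rQ'$ and, for real $f$, $$L_Qf=\frac{1}{r}\Big(\int_0^r Qf\,s\,ds\Big)Q+\Big(\partial_r-\frac{m+A_\theta[Q]}{r}\Big)f .$$ Let $\psi\neq0$ be a real profile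 with $\psi(r)e^{im\theta}\in H^1(\mathbb R^2)$, smooth on $(0,\infty)$ and rapidly decreasing with all its derivatives ($\sup_{r>0}r^k|\psi^{(n)}(r)|<\infty$ for all $k,n\ge 0$), that is a negative eigenfunction of the quadratic form $\|L_Qf\|_{L^2}^2+3(1-g)\int Q^2f^2\,dx$: there is $\kappa>0$ with $$\int L_Q\psi\,L_Qh\,dx+3(1-g)\int Q^2\psi h\,dx=-\kappa\int\psi h\,dx\qquad\text{for all real } h\in C_c^\infty((0,\infty)).$$ Assume that $\psi$ and $i\psi$ are transversal to the directions of scaling and phase rotation: $$\langle Q+x\cdot\nabla Q,\psi\rangle\neq0,\qquad \langle iQ,i\psi\rangle=\langle Q,\psi\rangle\neq0 .$$ Then for every $$K>\max\Big\{\frac{\|Q\|_{L^2}\|\psi\|_{L^2}}{|\langle Q,\psi\rangle|},\ \frac{\|\Lambda Q\|_{L^2}\|\psi\|_{L^2}}{|\langle \Lambda Q,\psi\rangle|}\Big\}$$ there are $\eta>0$ and $C>0$, depending only on $m,g,\alpha,Q,\psi,K$, such that the following holds for all $0<\eta_0\le\eta$. Let $I\subset\mathbb R$ be a set of times, let $u(t)\in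 L^2$ be a complex profile for each $t\in I$, and suppose that there are $\lambda_0(t)>0$, $\gamma_0(t)\in\mathbb R$ with $$\epsilon_0(t):=e^{i\gamma_0(t)}\lambda_0(t)u(t,\lambda_0(t)x)-Q(x),\qquad \|\epsilon_0(t)\|_{L^2}\le\eta_0\qquad(t\in I).$$ Then there are $\gamma(t)\in\mathbb R$, $\lambda(t)>0$ such that, for all $t\in I$, the function $\epsilon(t)=e^{i\gamma(t)}\lambda(t)u(t,\lambda(t)x)-Q(x)$ satisfies $$\|\epsilon(t)\|_{L^2}\le K\eta_0,\qquad \langle\epsilon(t),\psi\rangle=\langle\epsilon(t),i\psi\rangle=0,$$ and $$|\gamma(t)-\gamma_0(t)|+\Big|\frac{\lambda(t)}{\lambda_0(t)}-1\Big|\le C\big(\|\epsilon_0(t)\|_{L^2}+\|\epsilon_0(t)\|_{L^2}\|\epsilon_0(t)\|_{L^4}^2\big).$$ In particular $\|\epsilon(t)\|_{L^2}\le2\eta_0$ is obtained whenever the above maximum is less than $2$; for $\lambda_0=1$, $\gamma_0=0$ the last bound is one for $|\gamma|+|\lambda-1|$, with $\epsilon_0=u-Q$. -/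

import Mathlib

open MeasureTheory Set
open scoped ContDiff

noncomputable section

namespace CSS

/-- The measure `2π r dr` on `(0, ∞)`: integrals and `L^p` norms on the plane of radial functions,
and `L^p` norms of `m`-equivariant functions `f(r) e^{imθ}`, are those of the profile `f` for this
measure. -/
def radialMeasure : Measure ℝ :=
  (volume.restrict (Ioi (0 : ℝ))).withDensity fun r => ENNReal.ofReal (2 * Real.pi * r)

/-- The norm of a profile in `L^2(ℝ²)`, as a real number. -/
def l2Norm (f : ℝ → ℝ) : ℝ := (eLpNorm f 2 radialMeasure).toReal

/-- The real inner product `Re ∫ f \bar h dx` of `L^2(ℝ²; ℂ)`, on profiles. -/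
def l2Inner (f h : ℝ → ℂ) : ℝ := ∫ r, (f r * (starRingEnd ℂ) (h r)).re ∂radialMeasure

/-- A real profile seen as a complex one. -/
def toC (f : ℝ → ℝ) : ℝ → ℂ := fun r => (f r : ℂ)

/-- `A_θ[Q](r) = -(1/2) ∫_0^r |Q|² s ds`. -/
def Atheta (Q : ℝ → ℝ) (r : ℝ) : ℝ := -(1 / 2) * ∫ s in (0 : ℝ)..r, Q s ^ 2 * s

/-- `A_0[Q](r) = -∫_r^∞ (m + A_θ[Q](s)) |Q(s)|² ds/s`. -/
def Azero (m : ℕ) (Q : ℝ → ℝ) (r : ℝ) : ℝ :=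
  -∫ s in Ioi r, ((m : ℝ) + Atheta Q s) * Q s ^ 2 / s

/-- For a profile `f` differentiable on `(0, ∞)`: the function `f(r) e^{imθ}` belongs to
`H^1(ℝ²)`. Its gradient has squared length `|f'|² + |m f / r|²`. -/
structure MemH1 (m : ℕ) (f : ℝ → ℝ) : Prop where
  differentiableOn : DifferentiableOn ℝ f (Ioi 0)
  memLp : MemLp f 2 radialMeasure
  memLp_deriv : MemLp (deriv f) 2 radialMeasure
  memLp_angular : MemLp (fun r => (m : ℝ) / r * f r) 2 radialMeasure

/-- `Q` is the profile of a positive standing wave: a positive `m`-equivariant `H^1` solution of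
`ΔQ - (2m/r²) A_θ[Q] Q - A_0[Q] Q - (1/r²) A_θ[Q]² Q + g |Q|² Q - α Q = 0`, where `Δ` acts on
`Q(r) e^{imθ}`, that is, `ΔQ = Q'' + Q'/r - (m²/r²) Q` on profiles. -/
structure IsSoliton (m : ℕ) (g α : ℝ) (Q : ℝ → ℝ) : Prop where
  contDiffOn : ContDiffOn ℝ 2 Q (Ioi 0)
  memH1 : MemH1 m Q
  pos : ∀ r, 0 < r → 0 < Q r
  equation : ∀ r, 0 < r →
    (deriv (deriv Q) r + deriv Q r / r - (m : ℝ) ^ 2 / r ^ 2 * Q r)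
      - 2 * (m : ℝ) / r ^ 2 * Atheta Q r * Q r
      - Azero m Q r * Q r
      - 1 / r ^ 2 * Atheta Q r ^ 2 * Q r
      + g * Q r ^ 2 * Q r - α * Q r = 0

/-- The generator of the `L^2`-invariant scaling, `ΛQ = Q + x · ∇Q = Q + r Q'`. -/
def scalingGen (Q : ℝ → ℝ) (r : ℝ) : ℝ := Q r + r * deriv Q r

/-- `L_Q f = (1/r) (∫_0^r Q f s ds) Q + (∂_r - (m + A_θ[Q])/r) f`, for real `f`. -/
def linOp (m : ℕ) (Q f : ℝ → ℝ) (r : ℝ) : ℝ :=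
  (∫ s in (0 : ℝ)..r, Q s * f s * s) / r * Q r
    + (deriv f r - ((m : ℝ) + Atheta Q r) / r * f r)

/-- The symmetric bilinear form of the quadratic form
`‖L_Q f‖²_{L²} + 3 (1 - g) ∫ Q² f² dx`. -/
def energyForm (m : ℕ) (g : ℝ) (Q f h : ℝ → ℝ) : ℝ :=
  (∫ r, linOp m Q f r * linOp m Q h r ∂radialMeasure)
    + 3 * (1 - g) * ∫ r, Q r ^ 2 * f r * h r ∂radialMeasure

/-- Smooth on `(0, ∞)`, and every derivative decreases faster than every power of `r`. -/
def RapidlyDecreasing (f : ℝ → ℝ) : Prop :=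
  ContDiffOn ℝ ∞ f (Ioi 0) ∧
    ∀ k n : ℕ, ∃ C : ℝ, ∀ r, 0 < r → r ^ k * |iteratedDeriv n f r| ≤ C

/-- `ψ` is a rapidly decreasing negative eigenfunction of the quadratic form
`‖L_Q f‖²_{L²} + 3 (1 - g) ∫ Q² f² dx`, for an eigenvalue `-κ < 0`. -/
structure IsNegEigenfunction (m : ℕ) (g : ℝ) (Q ψ : ℝ → ℝ) : Prop where
  memH1 : MemH1 m ψ
  rapid : RapidlyDecreasing ψ
  ne_zero : ∃ r, 0 < r ∧ ψ r ≠ 0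
  eigen : ∃ κ : ℝ, 0 < κ ∧ ∀ h : ℝ → ℝ, ContDiff ℝ ∞ h → HasCompactSupport h →
    tsupport h ⊆ Ioi 0 →
      energyForm m g Q ψ h = -κ * ∫ r, ψ r * h r ∂radialMeasure

/-- The action of phase rotation and scaling, `e^{iγ} λ v(λ x)`. -/
def modulate (γ l : ℝ) (v : ℝ → ℂ) (r : ℝ) : ℂ :=
  Complex.exp (Complex.I * (γ : ℂ)) * (l : ℂ) * v (l * r)

/-- The remainder `e^{iγ} λ v(λ x) - Q(x)`. -/
def remainder (Q : ℝ → ℝ) (γ l : ℝ) (v : ℝ → ℂ) (r : ℝ) : ℂ := modulate γ l v r - toC Q r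

end CSS

end

/-!
# Modulation around a standing wave

After composing with the given rotation and scaling, the task is to find, for `v = Q + ε₀` with
`ε₀` small in `L²`, a phase `σ` and a scale `μ` near `(0, 1)` such that
`ε = e^{iσ} μ v(μ ·) - Q` is orthogonal to `ψ` and `iψ`, with a sharp bound on `‖ε‖`.

*Solving the orthogonality conditions.* They form the single complex equation
`e^{iσ} G(μ) = ⟨Q, ψ⟩`, where `G(μ) = ∫ μ v(μ ·) ψ`. The scale is found first, by the
intermediate value theorem for `|G(μ)| = |⟨Q, ψ⟩|`: the unperturbed part `⟨μ Q(μ ·), ψ⟩` has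
derivative `⟨ΛQ, ψ⟩ ≠ 0` at `μ = 1`, and the perturbation is at most `‖ε₀‖ ‖ψ‖`. The phase is then
read off. This gives `|σ| + |μ - 1| ≤ C ‖ε₀‖` without the `L⁴` term, and needs only the weak
continuity of dilations on `L²` (`exists_phase_scale`).

*The constant.* To first order, `ε` is the transformed `ε₀` plus a multiple of `ΛQ` in the real
part and a multiple of `Q` in the imaginary part. As both parts of `ε` are orthogonal to `ψ`, they
are oblique projections along `ΛQ` and `Q`, whose norms are the two quotients in the maximum
(`norm_mul_abs_inner_le_of_inner_eq_zero`); the strict inequality for `K` absorbs the second-order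
remainder (`exists_modulation`).

*Differentiability of the orbit.* The first-order expansion requires `μ ↦ μ Q(μ ·)` to be
differentiable in `L²` at `1` with derivative `ΛQ` (`hasDerivAt_dilateLp`). Difference quotients
converge pointwise, and their norms are asymptotically at most `‖ΛQ‖`, so that they converge in
norm by Fatou's lemma and the parallelogram law (`tendsto_Lp_of_ae_tendsto_of_norm_le`).

*Decay.* Finally `ΛQ` does belong to `L²` (`IsSoliton.memLp_scalingGen`): for large `r` the equation
has the form `(r Q')' = r W Q` with `W ≥ α / 2`, which for a positive `Q` tending to `0` forces
`r Q' = O(r⁻²)` (`exists_deriv_decay`).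
-/

namespace CSS

open Filter Topology
open scoped RealInnerProductSpace ENNReal

/-! ### Solving for phase and scale -/

theorem abs_arg_le_of_norm_eq_one {z : ℂ} (hz : ‖z‖ = 1) : |z.arg| ≤ Real.pi / 2 * ‖z - 1‖ := by
  have h := (Complex.norm_sub_mem_Icc_angle hz (y := 1) (by simp)).1
  have hz0 : z ≠ 0 := by
    rintro rfl
    simp at hz
  rw [InnerProductGeometry.angle_comm, Complex.angle_one_left hz0] at h
  have hp := Real.pi_pos
  calc |z.arg| = Real.pi / 2 * (2 / Real.pi * |z.arg|) := by field_simp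
    _ ≤ _ := by gcongr

/-- The case `f 1 = 1` of `exists_phase_scale`. The scale solves `‖f μ + h μ‖ = 1` by the
intermediate value theorem, and the phase is minus the argument of `f μ + h μ`. -/
theorem exists_phase_scale_normalized {f : ℝ → ℝ} {β : ℝ} (hf : HasDerivAt f β 1)
    (hfc : ContinuousOn f (Ioi 0)) (hf1 : f 1 = 1) (hβ : β ≠ 0) :
    ∃ η C : ℝ, 0 < η ∧ 0 < C ∧ ∀ (h : ℝ → ℂ) (d : ℝ), ContinuousOn h (Ioi 0) →
      (∀ μ, 0 < μ → ‖h μ‖ ≤ d) → d ≤ η →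
      ∃ σ μ : ℝ, 0 < μ ∧ Complex.exp (Complex.I * σ) * (f μ + h μ) = 1 ∧
        |σ| + |μ - 1| ≤ C * d := by
  have hβ' : 0 < |β| := abs_pos.2 hβ
  obtain ⟨δ, hδ, hlin⟩ : ∃ δ > 0, ∀ μ, |μ - 1| < δ →
      |f μ - 1 - β * (μ - 1)| ≤ |β| / 2 * |μ - 1| := by
    have h1 := hf.isLittleO.def (half_pos hβ')
    obtain ⟨δ, hδ, h⟩ := Metric.eventually_nhds_iff.1 h1
    refine ⟨δ, hδ, fun μ hμ => ?_⟩
    have := h (y := μ) (by simpa [Real.dist_eq] using hμ)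
    simpa [hf1, mul_comm] using this
  refine ⟨min (1 / 4) (|β| / 4 * min δ 1), 2 * Real.pi + 2 / |β|, by positivity, by positivity, ?_⟩
  intro h d hc hh hd
  have hd0 : 0 ≤ d := (norm_nonneg _).trans (hh 1 one_pos)
  have hd1 : d ≤ 1 / 4 := hd.trans (min_le_left _ _)
  have hd2 : d ≤ |β| / 4 * min δ 1 := hd.trans (min_le_right _ _)
  -- With this signed step, `f` moves by about `2 d`, enough to absorb the perturbation `h`.
  set s : ℝ := 2 * d / β with hs
  have hsabs : |s| = 2 * d / |β| := by rw [hs, abs_div, abs_of_nonneg (by positivity)]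
  have hβs : β * s = 2 * d := by rw [hs]; field_simp
  have hβs' : |β| * |s| = 2 * d := by rw [hsabs]; field_simp
  have hs1 : |s| ≤ min δ 1 / 2 := by
    rw [hsabs, div_le_iff₀ hβ']
    linarith
  have hm : 0 < min δ 1 := by positivity
  have hsδ : |s| < δ := by linarith [min_le_left δ 1]
  have hs2 : |s| ≤ 1 / 2 := by linarith [min_le_right δ 1]
  have hsub : ∀ μ ∈ uIcc (1 - s) (1 + s), |μ - 1| ≤ |s| := by
    intro μ hμ
    rw [mem_uIcc] at hμ
    rw [abs_le]
    rcases hμ with ⟨h1, h2⟩ | ⟨h1, h2⟩ <;> constructor <;>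
      linarith [le_abs_self s, neg_abs_le s]
  have hpos : ∀ μ ∈ uIcc (1 - s) (1 + s), 0 < μ := by
    intro μ hμ
    have := (abs_le.1 (hsub μ hμ)).1
    linarith
  have hcont : ContinuousOn (fun μ => ‖(f μ : ℂ) + h μ‖) (uIcc (1 - s) (1 + s)) := by
    have h1 : ContinuousOn (fun μ => (f μ : ℂ)) (Ioi 0) :=
      Complex.continuous_ofReal.comp_continuousOn hfc
    exact ((h1.add hc).norm).mono hpos
  have hup : 1 ≤ ‖(f (1 + s) : ℂ) + h (1 + s)‖ := by
    have h1 := hlin (1 + s) (by simpa using hsδ)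
    have h2 := hh (1 + s) (hpos _ right_mem_uIcc)
    rw [add_sub_cancel_left] at h1
    have h3 := (abs_le.1 h1).1
    have h4 : (f (1 + s)) ≤ ‖(f (1 + s) : ℂ)‖ := by
      rw [Complex.norm_real]; exact le_abs_self _
    have h5 := norm_sub_le ((f (1 + s) : ℂ) + h (1 + s)) (h (1 + s))
    rw [add_sub_cancel_right] at h5
    nlinarith
  have hlow : ‖(f (1 - s) : ℂ) + h (1 - s)‖ ≤ 1 := by
    have h1 := hlin (1 - s) (by simpa using hsδ)
    have h2 := hh (1 - s) (hpos _ left_mem_uIcc)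
    rw [show 1 - s - 1 = -s by ring, abs_neg] at h1
    have h3 := abs_le.1 h1
    have h4 : ‖(f (1 - s) : ℂ)‖ = f (1 - s) := by
      rw [Complex.norm_real]
      apply abs_of_nonneg
      nlinarith [h3.1]
    have h5 := norm_add_le (f (1 - s) : ℂ) (h (1 - s))
    nlinarith [h3.2]
  obtain ⟨μ, hμ, hμ1⟩ : (1 : ℝ) ∈ (fun μ => ‖(f μ : ℂ) + h μ‖) '' uIcc (1 - s) (1 + s) :=
    intermediate_value_uIcc hcont (by rw [mem_uIcc]; exact Or.inl ⟨hlow, hup⟩)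
  simp only at hμ1
  set z : ℂ := (f μ : ℂ) + h μ with hz
  refine ⟨-z.arg, μ, hpos μ hμ, ?_, ?_⟩
  · have h1 := Complex.norm_mul_exp_arg_mul_I z
    rw [hμ1, Complex.ofReal_one, one_mul] at h1
    rw [← hz]
    calc Complex.exp (Complex.I * ((-z.arg : ℝ) : ℂ)) * z
        = Complex.exp (Complex.I * ((-z.arg : ℝ) : ℂ)) * Complex.exp (z.arg * Complex.I) := by
          rw [h1]
      _ = 1 := ?_
    rw [← Complex.exp_add]
    push_cast
    rw [show Complex.I * -(z.arg : ℂ) + z.arg * Complex.I = 0 by ring, Complex.exp_zero]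
  · have h1 := abs_arg_le_of_norm_eq_one hμ1
    have h2 := hsub μ hμ
    have h3 := hlin μ (h2.trans_lt hsδ)
    have h4 : |f μ - 1| ≤ |β| / 2 * |μ - 1| + |β| * |μ - 1| := by
      calc |f μ - 1| = |(f μ - 1 - β * (μ - 1)) + β * (μ - 1)| := by ring_nf
        _ ≤ |f μ - 1 - β * (μ - 1)| + |β * (μ - 1)| := abs_add_le _ _
        _ ≤ _ := by rw [abs_mul]; linarith
    have h5 : ‖z - 1‖ ≤ |f μ - 1| + ‖h μ‖ := by
      rw [hz, show (f μ : ℂ) + h μ - 1 = ((f μ - 1 : ℝ) : ℂ) + h μ by push_cast; ring]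
      refine (norm_add_le _ _).trans ?_
      rw [Complex.norm_real, Real.norm_eq_abs]
    have h6 := hh μ (hpos μ hμ)
    have h7 : ‖z - 1‖ ≤ 4 * d := by nlinarith
    rw [abs_neg]
    have h8 : Real.pi / 2 * ‖z - 1‖ ≤ Real.pi / 2 * (4 * d) := by gcongr
    calc |z.arg| + |μ - 1| ≤ Real.pi / 2 * (4 * d) + 2 * d / |β| := by linarith
      _ = _ := by ring

/-- If `f` is nonzero with nonzero derivative at `1`, then `e^{iσ} (f μ + h μ) = f 1` is
solvable with `|σ| + |μ - 1| = O(d)`, for every complex perturbation `h` bounded by a small `d`.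
Only continuity of `h` is assumed, so that the inverse function theorem does not apply. -/
theorem exists_phase_scale {f : ℝ → ℝ} {a b : ℝ} (hf : HasDerivAt f b 1)
    (hfc : ContinuousOn f (Ioi 0)) (hf1 : f 1 = a) (ha : a ≠ 0) (hb : b ≠ 0) :
    ∃ η C : ℝ, 0 < η ∧ 0 < C ∧ ∀ (h : ℝ → ℂ) (d : ℝ), ContinuousOn h (Ioi 0) →
      (∀ μ, 0 < μ → ‖h μ‖ ≤ d) → d ≤ η →
      ∃ σ μ : ℝ, 0 < μ ∧ Complex.exp (Complex.I * σ) * (f μ + h μ) = a ∧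
        |σ| + |μ - 1| ≤ C * d := by
  have ha' : 0 < |a| := abs_pos.2 ha
  obtain ⟨η, C, hη, hC, H⟩ := exists_phase_scale_normalized (f := fun μ => f μ / a)
    (hf.div_const a) (hfc.div_const a) (by simp [hf1, ha]) (div_ne_zero hb ha)
  refine ⟨|a| * η, C / |a|, by positivity, by positivity, fun h d hc hh hd => ?_⟩
  obtain ⟨σ, μ, hμ, h1, h2⟩ := H (fun μ => h μ / a) (d / |a|) (hc.div_const _)
    (fun μ hμ => by
      rw [norm_div, Complex.norm_real, Real.norm_eq_abs]
      gcongr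
      exact hh μ hμ)
    (by rw [div_le_iff₀ ha']; linarith)
  refine ⟨σ, μ, hμ, ?_, ?_⟩
  · have ha'' : (a : ℂ) ≠ 0 := by exact_mod_cast ha
    push_cast at h1
    field_simp at h1
    linear_combination h1
  · calc _ ≤ C * (d / |a|) := h2
      _ = _ := by ring

/-! ### Modulation in a real Hilbert space -/

section Abstract

variable {E : Type*} [NormedAddCommGroup E] [InnerProductSpace ℝ E]

/-- The norm of the oblique projection onto `p^⊥` along `l` is at most `‖l‖ ‖p‖ / |⟪l, p⟫|`: here
`y ∈ p^⊥` is the projection of `y - t • l`. -/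
theorem norm_mul_abs_inner_le_of_inner_eq_zero {y p : E} (hy : ⟪y, p⟫ = 0) (l : E) (t : ℝ) :
    ‖y‖ * |⟪l, p⟫| ≤ ‖l‖ * ‖p‖ * ‖y - t • l‖ := by
  have h1 : ‖y‖ ^ 2 * ⟪l, p⟫ = ⟪‖y‖ ^ 2 • l - ⟪l, y⟫ • y, p⟫ := by
    rw [inner_sub_left, inner_smul_left, inner_smul_left, hy]
    simp
  have h2 : ‖‖y‖ ^ 2 • l - ⟪l, y⟫ • y‖ ^ 2 = ‖y‖ ^ 2 * (‖y‖ ^ 2 * ‖l‖ ^ 2 - ⟪l, y⟫ ^ 2) := by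
    rw [norm_sub_sq_real, norm_smul, norm_smul, inner_smul_left, inner_smul_right]
    simp only [Real.norm_eq_abs, mul_pow, sq_abs, conj_trivial]
    ring
  have h3 : ‖y‖ ^ 2 * ‖l‖ ^ 2 - ⟪l, y⟫ ^ 2 ≤ ‖l‖ ^ 2 * ‖y - t • l‖ ^ 2 := by
    rw [norm_sub_sq_real, norm_smul, inner_smul_right, real_inner_comm, mul_pow,
      Real.norm_eq_abs, sq_abs]
    nlinarith [sq_nonneg (⟪y, l⟫ - t * ‖l‖ ^ 2)]
  rcases eq_or_ne y 0 with rfl | hy0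
  · simp only [norm_zero, zero_mul]; positivity
  have hyp : 0 < ‖y‖ := norm_pos_iff.2 hy0
  have h4 : (‖y‖ ^ 2 * |⟪l, p⟫|) ≤ ‖‖y‖ ^ 2 • l - ⟪l, y⟫ • y‖ * ‖p‖ := by
    have := abs_real_inner_le_norm (‖y‖ ^ 2 • l - ⟪l, y⟫ • y) p
    rwa [← h1, abs_mul, abs_of_nonneg (by positivity)] at this
  have h5 : ‖‖y‖ ^ 2 • l - ⟪l, y⟫ • y‖ ≤ ‖y‖ * (‖l‖ * ‖y - t • l‖) := by
    refine (pow_le_pow_iff_left₀ (by positivity) (by positivity) two_ne_zero).1 ?_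
    rw [h2, mul_pow, mul_pow]
    gcongr
  have h6 : ‖y‖ * (‖y‖ * |⟪l, p⟫|) ≤ ‖y‖ * (‖l‖ * ‖p‖ * ‖y - t • l‖) := by
    calc _ = ‖y‖ ^ 2 * |⟪l, p⟫| := by ring
      _ ≤ ‖y‖ * (‖l‖ * ‖y - t • l‖) * ‖p‖ := h4.trans (by gcongr)
      _ = _ := by ring
  exact le_of_mul_le_mul_left h6 hyp

theorem norm_rotation_sq (σ : ℝ) (x y : E) :
    ‖Real.cos σ • x - Real.sin σ • y‖ ^ 2 + ‖Real.sin σ • x + Real.cos σ • y‖ ^ 2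
      = ‖x‖ ^ 2 + ‖y‖ ^ 2 := by
  rw [norm_sub_sq_real, norm_add_sq_real]
  simp only [norm_smul, inner_smul_left, inner_smul_right, mul_pow, Real.norm_eq_abs, sq_abs,
    conj_trivial]
  linear_combination (‖x‖ ^ 2 + ‖y‖ ^ 2) * Real.sin_sq_add_cos_sq σ

/-- The real and imaginary parts of `e^{iσ} q(μ)` agree to first order at `(0, 1)` with
`q 1 + (μ - 1) l` and `σ q 1`. -/
theorem exists_rotation_remainder_le {q : ℝ → E} {l : E} (hq : HasDerivAt q l 1) {κ : ℝ}
    (hκ : 0 < κ) :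
    ∃ δ > 0, ∀ σ μ : ℝ, |σ| + |μ - 1| < δ →
      ‖Real.cos σ • q μ - q 1 - (μ - 1) • l‖ ≤ κ * (|σ| + |μ - 1|) ∧
      ‖Real.sin σ • q μ - σ • q 1‖ ≤ κ * (|σ| + |μ - 1|) := by
  have hq2 : HasFDerivAt (fun x : ℝ × ℝ => q x.2) _ ((0 : ℝ), (1 : ℝ)) :=
    HasFDerivAt.comp (g := q) (f := Prod.snd) ((0 : ℝ), (1 : ℝ)) hq.hasFDerivAt hasFDerivAt_snd
  have hc2 : HasFDerivAt (fun x : ℝ × ℝ => Real.cos x.1) _ ((0 : ℝ), (1 : ℝ)) :=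
    HasFDerivAt.comp (g := Real.cos) (f := Prod.fst) ((0 : ℝ), (1 : ℝ))
      (Real.hasDerivAt_cos 0).hasFDerivAt hasFDerivAt_fst
  have hs2 : HasFDerivAt (fun x : ℝ × ℝ => Real.sin x.1) _ ((0 : ℝ), (1 : ℝ)) :=
    HasFDerivAt.comp (g := Real.sin) (f := Prod.fst) ((0 : ℝ), (1 : ℝ))
      (Real.hasDerivAt_sin 0).hasFDerivAt hasFDerivAt_fst
  have h1 := (hc2.smul hq2).isLittleO.def hκ
  have h2 := (hs2.smul hq2).isLittleO.def hκ
  obtain ⟨δ, hδ, h⟩ := Metric.eventually_nhds_iff.1 (h1.and h2)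
  refine ⟨δ, hδ, fun σ μ hσμ => ?_⟩
  have hle : ‖((σ, μ) : ℝ × ℝ) - (0, 1)‖ ≤ |σ| + |μ - 1| := by
    simp only [Prod.mk_sub_mk, sub_zero, Prod.norm_mk, Real.norm_eq_abs]
    exact max_le (by linarith [abs_nonneg (μ - 1)]) (by linarith [abs_nonneg σ])
  obtain ⟨h3, h4⟩ := h (y := (σ, μ)) (by rw [dist_eq_norm]; exact hle.trans_lt hσμ)
  constructor
  · refine le_trans (le_of_eq ?_) (h3.trans (mul_le_mul_of_nonneg_left hle hκ.le))
    simp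
  · refine le_trans (le_of_eq ?_) (h4.trans (mul_le_mul_of_nonneg_left hle hκ.le))
    simp

/-- The modulation argument in a real Hilbert space. The curves `q`, `e₁`, `e₂` stand for the
dilates of the standing wave and of the real and imaginary parts of the perturbation; complex
multiplication by `e^{iσ}` is written as a rotation of the pair of parts. -/
theorem exists_modulation {q : ℝ → E} {l p : E} (hq : HasDerivAt q l 1)
    (hqc : ContinuousOn (fun μ => ⟪q μ, p⟫) (Ioi 0)) (hphase : ⟪q 1, p⟫ ≠ 0)
    (hscale : ⟪l, p⟫ ≠ 0) {K : ℝ}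
    (hK : max (‖q 1‖ * ‖p‖ / |⟪q 1, p⟫|) (‖l‖ * ‖p‖ / |⟪l, p⟫|) < K) :
    ∃ η C : ℝ, 0 < η ∧ 0 < C ∧ ∀ (e₁ e₂ : ℝ → E) (d : ℝ), 0 ≤ d → d ≤ η →
      (∀ μ, 0 < μ → ‖e₁ μ‖ ^ 2 + ‖e₂ μ‖ ^ 2 = d ^ 2) →
      ContinuousOn (fun μ => ⟪e₁ μ, p⟫) (Ioi 0) → ContinuousOn (fun μ => ⟪e₂ μ, p⟫) (Ioi 0) →
      ∃ σ μ : ℝ, 0 < μ ∧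
        ⟪Real.cos σ • (q μ + e₁ μ) - Real.sin σ • e₂ μ - q 1, p⟫ = 0 ∧
        ⟪Real.sin σ • (q μ + e₁ μ) + Real.cos σ • e₂ μ, p⟫ = 0 ∧
        ‖Real.cos σ • (q μ + e₁ μ) - Real.sin σ • e₂ μ - q 1‖ ^ 2
          + ‖Real.sin σ • (q μ + e₁ μ) + Real.cos σ • e₂ μ‖ ^ 2 ≤ (K * d) ^ 2 ∧
        |σ| + |μ - 1| ≤ C * d := by
  set M := max (‖q 1‖ * ‖p‖ / |⟪q 1, p⟫|) (‖l‖ * ‖p‖ / |⟪l, p⟫|) with hM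
  have hM0 : 0 ≤ M := le_max_of_le_left (by positivity)
  have hfd : HasDerivAt (fun μ => ⟪q μ, p⟫) ⟪l, p⟫ 1 := by
    simpa using hq.inner ℝ (hasDerivAt_const (1 : ℝ) p)
  obtain ⟨η₁, C₁, hη₁, hC₁, H⟩ := exists_phase_scale hfd hqc rfl hphase hscale
  set C := C₁ * (‖p‖ + 1) with hC
  have hC0 : 0 < C := by positivity
  -- `κ` is chosen so that `M (1 + 2 κ) ≤ K`.
  set κ := (K - M) / (2 * M + 2) with hκ
  have hκ0 : 0 < κ := div_pos (sub_pos.2 hK) (by positivity)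
  have hMκ : M * (1 + 2 * κ) ≤ K := by
    have : κ * (2 * M + 2) = K - M := by rw [hκ]; field_simp
    nlinarith
  obtain ⟨δ, hδ, hR⟩ := exists_rotation_remainder_le hq (div_pos hκ0 hC0)
  refine ⟨min (η₁ / (‖p‖ + 1)) (δ / (2 * C)), C, by positivity, hC0, ?_⟩
  intro e₁ e₂ d hd0 hd hnorm hc₁ hc₂
  have hd1 : d * (‖p‖ + 1) ≤ η₁ := (le_div_iff₀ (by positivity)).1 (hd.trans (min_le_left _ _))
  have hd2 : d * (2 * C) ≤ δ := (le_div_iff₀ (by positivity)).1 (hd.trans (min_le_right _ _))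
  obtain ⟨σ, μ, hμ, heq, hσμ⟩ := H (fun μ => (⟪e₁ μ, p⟫ : ℂ) + (⟪e₂ μ, p⟫ : ℂ) * Complex.I)
    (d * (‖p‖ + 1))
    ((Complex.continuous_ofReal.comp_continuousOn hc₁).add
      ((Complex.continuous_ofReal.comp_continuousOn hc₂).mul continuousOn_const))
    (fun μ hμ => by
      refine (pow_le_pow_iff_left₀ (by positivity) (by positivity) two_ne_zero).1 ?_
      rw [← Complex.normSq_eq_norm_sq, Complex.normSq_add_mul_I]
      have h1 := real_inner_mul_inner_self_le (e₁ μ) p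
      have h2 := real_inner_mul_inner_self_le (e₂ μ) p
      simp only [real_inner_self_eq_norm_sq] at h1 h2
      have h3 := hnorm μ hμ
      have h4 : ‖p‖ ^ 2 ≤ (‖p‖ + 1) ^ 2 := by gcongr; linarith
      calc ⟪e₁ μ, p⟫ ^ 2 + ⟪e₂ μ, p⟫ ^ 2 ≤ (‖e₁ μ‖ ^ 2 + ‖e₂ μ‖ ^ 2) * ‖p‖ ^ 2 := by nlinarith
        _ ≤ _ := by rw [h3, mul_pow]; gcongr)
    hd1
  have hσμ' : |σ| + |μ - 1| ≤ C * d := by rw [hC]; linarith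
  have hlt : |σ| + |μ - 1| < δ ∨ d = 0 := by
    rcases hd0.eq_or_lt with h | h
    · exact Or.inr h.symm
    · left; nlinarith
  have hlt : |σ| + |μ - 1| < δ := by
    rcases hlt with h | h
    · exact h
    · rw [h, mul_zero] at hσμ'; linarith
  obtain ⟨hR₁, hR₂⟩ := hR σ μ hlt
  have hκd : κ / C * (|σ| + |μ - 1|) ≤ κ * d := by
    calc _ ≤ κ / C * (C * d) := by gcongr
      _ = _ := by field_simp
  rw [mul_comm Complex.I, Complex.exp_mul_I, ← Complex.ofReal_cos,
    ← Complex.ofReal_sin] at heq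
  have hre := congrArg Complex.re heq
  have him := congrArg Complex.im heq
  simp [-Complex.ofReal_cos, -Complex.ofReal_sin] at hre him
  -- The real and imaginary parts of the scalar equation are the two orthogonality conditions.
  have horth₁ : ⟪Real.cos σ • (q μ + e₁ μ) - Real.sin σ • e₂ μ - q 1, p⟫ = 0 := by
    simp only [inner_sub_left, inner_add_left, inner_smul_left, conj_trivial]
    linarith
  have horth₂ : ⟪Real.sin σ • (q μ + e₁ μ) + Real.cos σ • e₂ μ, p⟫ = 0 := by
    simp only [inner_add_left, inner_smul_left, conj_trivial]
    linarith
  refine ⟨σ, μ, hμ, horth₁, horth₂, ?_, hσμ'⟩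
  have hrot := norm_rotation_sq σ (e₁ μ) (e₂ μ)
  rw [hnorm μ hμ] at hrot
  set x₁ := Real.cos σ • e₁ μ - Real.sin σ • e₂ μ with hx₁
  set x₂ := Real.sin σ • e₁ μ + Real.cos σ • e₂ μ with hx₂
  set y₁ := Real.cos σ • (q μ + e₁ μ) - Real.sin σ • e₂ μ - q 1 with hy₁
  set y₂ := Real.sin σ • (q μ + e₁ μ) + Real.cos σ • e₂ μ with hy₂
  have b₁ : ‖y₁‖ ≤ M * (‖x₁‖ + κ * d) := by
    have h1 := norm_mul_abs_inner_le_of_inner_eq_zero horth₁ l (μ - 1)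
    have h2 : y₁ - (μ - 1) • l = x₁ + (Real.cos σ • q μ - q 1 - (μ - 1) • l) := by
      rw [hy₁, hx₁, smul_add]; abel
    have h3 : ‖y₁ - (μ - 1) • l‖ ≤ ‖x₁‖ + κ * d := by
      rw [h2]; exact (norm_add_le _ _).trans (by linarith)
    calc ‖y₁‖ ≤ ‖l‖ * ‖p‖ * ‖y₁ - (μ - 1) • l‖ / |⟪l, p⟫| :=
          (le_div_iff₀ (abs_pos.2 hscale)).2 h1
      _ = ‖l‖ * ‖p‖ / |⟪l, p⟫| * ‖y₁ - (μ - 1) • l‖ := by ring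
      _ ≤ M * (‖x₁‖ + κ * d) := by gcongr; exact le_max_right _ _
  have b₂ : ‖y₂‖ ≤ M * (‖x₂‖ + κ * d) := by
    have h1 := norm_mul_abs_inner_le_of_inner_eq_zero horth₂ (q 1) σ
    have h2 : y₂ - σ • q 1 = x₂ + (Real.sin σ • q μ - σ • q 1) := by
      rw [hy₂, hx₂, smul_add]; abel
    have h3 : ‖y₂ - σ • q 1‖ ≤ ‖x₂‖ + κ * d := by
      rw [h2]; exact (norm_add_le _ _).trans (by linarith)
    calc ‖y₂‖ ≤ ‖q 1‖ * ‖p‖ * ‖y₂ - σ • q 1‖ / |⟪q 1, p⟫| :=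
          (le_div_iff₀ (abs_pos.2 hphase)).2 h1
      _ = ‖q 1‖ * ‖p‖ / |⟪q 1, p⟫| * ‖y₂ - σ • q 1‖ := by ring
      _ ≤ M * (‖x₂‖ + κ * d) := by gcongr; exact le_max_left _ _
  have hx₁d : ‖x₁‖ ≤ d := (pow_le_pow_iff_left₀ (by positivity) (by positivity) two_ne_zero).1
    (by nlinarith [sq_nonneg ‖x₂‖])
  have hx₂d : ‖x₂‖ ≤ d := (pow_le_pow_iff_left₀ (by positivity) (by positivity) two_ne_zero).1
    (by nlinarith [sq_nonneg ‖x₁‖])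
  calc ‖y₁‖ ^ 2 + ‖y₂‖ ^ 2 ≤ (M * (‖x₁‖ + κ * d)) ^ 2 + (M * (‖x₂‖ + κ * d)) ^ 2 := by gcongr
    _ = M ^ 2 * (d ^ 2 + 2 * (κ * d) * (‖x₁‖ + ‖x₂‖) + 2 * (κ * d) ^ 2) := by
        rw [← hrot]; ring
    _ ≤ M ^ 2 * (d ^ 2 + 2 * (κ * d) * (d + d) + 4 * (κ * d) ^ 2) := by
        gcongr; norm_num
    _ = (M * (1 + 2 * κ) * d) ^ 2 := by ring
    _ ≤ (K * d) ^ 2 :=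
        pow_le_pow_left₀ (by positivity) (mul_le_mul_of_nonneg_right hMκ hd0) 2

end Abstract

/-! ### Norm convergence from pointwise convergence -/

/-- Uniform convexity: if the norms of `F n` are asymptotically at most `‖G‖` and those of
`F n + G` at least `2 ‖G‖`, then `F n` tends to `G`. -/
theorem tendsto_of_norm_add_lower_bound {ι E : Type*} [NormedAddCommGroup E]
    [InnerProductSpace ℝ E] {u : Filter ι} {F : ι → E} {G : E} {B : ι → ℝ}
    (hB : Tendsto B u (𝓝 ‖G‖)) (hFB : ∀ᶠ n in u, ‖F n‖ ≤ B n)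
    (hlow : ∀ c < 2 * ‖G‖, ∀ᶠ n in u, c < ‖F n + G‖) : Tendsto F u (𝓝 G) := by
  have hadd : Tendsto (fun n => ‖F n + G‖) u (𝓝 (2 * ‖G‖)) := by
    refine tendsto_order.2 ⟨hlow, fun c hc => ?_⟩
    have h1 : Tendsto (fun n => B n + ‖G‖) u (𝓝 (‖G‖ + ‖G‖)) := hB.add_const _
    filter_upwards [hFB, h1.eventually_lt_const (by linarith : ‖G‖ + ‖G‖ < c)] with n h2 h3
    exact (norm_add_le _ _).trans_lt (by linarith)
  have hsq : Tendsto (fun n => ‖F n - G‖ ^ 2) u (𝓝 0) := by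
    have h1 : Tendsto (fun n => 2 * B n ^ 2 + 2 * ‖G‖ ^ 2 - ‖F n + G‖ ^ 2) u
        (𝓝 (2 * ‖G‖ ^ 2 + 2 * ‖G‖ ^ 2 - (2 * ‖G‖) ^ 2)) :=
      (((hB.pow 2).const_mul 2).add_const _).sub (hadd.pow 2)
    rw [show 2 * ‖G‖ ^ 2 + 2 * ‖G‖ ^ 2 - (2 * ‖G‖) ^ 2 = 0 by ring] at h1
    refine tendsto_of_tendsto_of_tendsto_of_le_of_le' tendsto_const_nhds h1
      (Eventually.of_forall fun n => by positivity) ?_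
    filter_upwards [hFB] with n hn
    have h2 := parallelogram_law_with_norm ℝ (F n) G
    have h3 : ‖F n‖ ^ 2 ≤ B n ^ 2 := by gcongr
    nlinarith
  rw [tendsto_iff_norm_sub_tendsto_zero]
  have := (Real.continuous_sqrt.tendsto 0).comp hsq
  simpa [Function.comp_def, Real.sqrt_sq] using this

/-- Pointwise convergence, together with norms asymptotically at most that of the limit, implies
convergence in `L²`. The representatives `f n` of `F n` are given because the index set may be
uncountable; Fatou's lemma bounds `‖F n + G‖` from below. -/
theorem tendsto_Lp_of_ae_tendsto_of_norm_le {ι α : Type*} [MeasurableSpace α] {ν : Measure α}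
    {u : Filter ι} [u.IsCountablyGenerated] {F : ι → Lp ℝ 2 ν} {f : ι → α → ℝ} {G : Lp ℝ 2 ν}
    {B : ι → ℝ} (hF : ∀ᶠ n in u, F n =ᵐ[ν] f n)
    (hlim : ∀ᵐ x ∂ν, Tendsto (fun n => f n x) u (𝓝 (G x)))
    (hB : Tendsto B u (𝓝 ‖G‖)) (hFB : ∀ᶠ n in u, ‖F n‖ ≤ B n) : Tendsto F u (𝓝 G) := by
  refine tendsto_of_seq_tendsto fun v hv => ?_
  refine tendsto_of_norm_add_lower_bound (hB.comp hv) (hv.eventually hFB) fun c hc => ?_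
  obtain ⟨N, hN⟩ := eventually_atTop.1 (hv.eventually hF)
  have hae : ∀ᵐ x ∂ν, Tendsto (fun n => (F (v n) + G : Lp ℝ 2 ν) x) atTop
      (𝓝 ((G + G : Lp ℝ 2 ν) x)) := by
    have h1 : ∀ᵐ x ∂ν, ∀ n, N ≤ n → F (v n) x = f (v n) x := by
      refine ae_all_iff.2 fun n => ?_
      by_cases hn : N ≤ n
      · filter_upwards [hN n hn] with x hx _ using hx
      · exact Eventually.of_forall fun x h => absurd h hn
    have h2 : ∀ᵐ x ∂ν, ∀ n, (F (v n) + G : Lp ℝ 2 ν) x = F (v n) x + G x :=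
      ae_all_iff.2 fun n => Lp.coeFn_add _ _
    filter_upwards [h1, h2, hlim, Lp.coeFn_add G G] with x h1 h2 h3 h4
    simp only [h2, h4, Pi.add_apply]
    refine Tendsto.add_const _ ((h3.comp hv).congr' ?_)
    filter_upwards [eventually_ge_atTop N] with n hn using (h1 n hn).symm
  have hfatou := Lp.eLpNorm_lim_le_liminf_eLpNorm (p := 2)
    (fun n => Lp.aestronglyMeasurable (F (v n) + G)) _ hae
  rcases lt_or_ge c 0 with hc0 | hc0
  · exact Eventually.of_forall fun n => hc0.trans_le (norm_nonneg _)
  have hlt : ENNReal.ofReal c < atTop.liminf fun n => eLpNorm (F (v n) + G : Lp ℝ 2 ν) 2 ν := by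
    refine lt_of_lt_of_le ?_ hfatou
    rw [ENNReal.ofReal_lt_iff_lt_toReal hc0 (Lp.eLpNorm_ne_top _), ← Lp.norm_def, ← two_smul ℝ G,
      norm_smul]
    simpa using hc
  filter_upwards [eventually_lt_of_lt_liminf hlt] with n hn
  rw [ENNReal.ofReal_lt_iff_lt_toReal hc0 (Lp.eLpNorm_ne_top _), ← Lp.norm_def] at hn
  exact hn

theorem sq_lintegral_le {α : Type*} [MeasurableSpace α] (ν : Measure α) {f : α → ℝ≥0∞}
    (hf : AEMeasurable f ν) : (∫⁻ x, f x ∂ν) ^ 2 ≤ ν univ * ∫⁻ x, f x ^ 2 ∂ν := by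
  have h := ENNReal.lintegral_mul_le_Lp_mul_Lq ν Real.HolderConjugate.two_two hf
    (aemeasurable_const (b := (1 : ℝ≥0∞)))
  simp only [Pi.mul_apply, mul_one, ENNReal.one_rpow, lintegral_const, one_mul] at h
  calc (∫⁻ x, f x ∂ν) ^ 2
      ≤ ((∫⁻ x, f x ^ (2 : ℝ) ∂ν) ^ (1 / 2 : ℝ) * ν univ ^ (1 / 2 : ℝ)) ^ 2 := by
        gcongr
    _ = _ := by
        rw [mul_pow, ← ENNReal.rpow_natCast, ← ENNReal.rpow_natCast, ← ENNReal.rpow_mul,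
          ← ENNReal.rpow_mul, mul_comm]
        norm_num

/-! ### Dilations of the radial measure -/

instance : SFinite radialMeasure := by
  unfold radialMeasure
  infer_instance

theorem ae_radialMeasure_pos : ∀ᵐ r ∂radialMeasure, 0 < r := by
  refine (withDensity_absolutelyContinuous _ _).ae_le ?_
  exact ae_restrict_mem measurableSet_Ioi

theorem map_mul_left_radialMeasure {l : ℝ} (hl : 0 < l) :
    radialMeasure.map (l * ·) = ENNReal.ofReal (l⁻¹ ^ 2) • radialMeasure := by
  have hm : Measurable (l * · : ℝ → ℝ) := measurable_const_mul l
  have hvol : (volume.restrict (Ioi (0 : ℝ))).map (l * ·)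
      = ENNReal.ofReal l⁻¹ • volume.restrict (Ioi (0 : ℝ)) := by
    have h1 := Measure.restrict_map (μ := volume) hm (measurableSet_Ioi (a := (0 : ℝ)))
    rw [Real.map_volume_mul_left hl.ne', Measure.restrict_smul,
      abs_of_pos (inv_pos.2 hl)] at h1
    rw [h1]
    congr 2
    ext x
    simp [hl]
  have hw : Measurable fun r : ℝ => ENNReal.ofReal (2 * Real.pi * r) := by fun_prop
  ext s hs
  rw [Measure.map_apply hm hs, Measure.smul_apply, radialMeasure, withDensity_apply _ (hm hs),
    withDensity_apply _ hs]
  have h2 : ∀ r : ℝ, ENNReal.ofReal (2 * Real.pi * r)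
      = ENNReal.ofReal l⁻¹ * ENNReal.ofReal (2 * Real.pi * (l * r)) := by
    intro r
    rw [← ENNReal.ofReal_mul (by positivity)]
    congr 1
    field_simp
  rw [lintegral_congr h2, lintegral_const_mul _ (by fun_prop)]
  have h3 := setLIntegral_map (μ := volume.restrict (Ioi (0 : ℝ))) hs hw hm
  rw [← h3, hvol, Measure.restrict_smul, lintegral_smul_measure, smul_eq_mul, smul_eq_mul,
    ← mul_assoc, ← ENNReal.ofReal_mul (by positivity), sq]

/-- The `L²`-normalized dilate `l f(l r)` of a profile. -/
noncomputable def dilate (l : ℝ) (f : ℝ → ℝ) (r : ℝ) : ℝ := l * f (l * r)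

theorem measurableEmbedding_mul_left {l : ℝ} (hl : 0 < l) :
    MeasurableEmbedding (l * · : ℝ → ℝ) :=
  measurableEmbedding_mulLeft₀ hl.ne'

theorem aestronglyMeasurable_comp_mul {l : ℝ} (hl : 0 < l) {β : Type*}
    [TopologicalSpace β] {f : ℝ → β} (hf : AEStronglyMeasurable f radialMeasure) :
    AEStronglyMeasurable (fun r => f (l * r)) radialMeasure := by
  have : AEStronglyMeasurable f (radialMeasure.map (l * ·)) := by
    rw [map_mul_left_radialMeasure hl]
    exact hf.smul_measure _
  exact this.comp_measurable (measurable_const_mul l)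

theorem eLpNorm_dilate {l : ℝ} (hl : 0 < l) (f : ℝ → ℝ) :
    eLpNorm (dilate l f) 2 radialMeasure = eLpNorm f 2 radialMeasure := by
  have h1 := (measurableEmbedding_mul_left hl).eLpNorm_map_measure (g := f) (p := 2)
    (μ := radialMeasure)
  rw [map_mul_left_radialMeasure hl,
    eLpNorm_smul_measure_of_ne_top (by norm_num)] at h1
  have h2 : dilate l f = l • (f ∘ (l * ·)) := rfl
  rw [h2, eLpNorm_const_smul, ← h1, smul_eq_mul, ← mul_assoc, Real.enorm_eq_ofReal hl.le,
    ENNReal.ofReal_rpow_of_nonneg (by positivity) (by positivity),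
    ← ENNReal.ofReal_mul hl.le]
  have h3 : l * (l⁻¹ ^ 2) ^ (1 / (2 : ℝ≥0∞)).toReal = 1 := by
    have : (1 / (2 : ℝ≥0∞)).toReal = 1 / 2 := by simp
    rw [this, ← Real.sqrt_eq_rpow, Real.sqrt_sq (by positivity)]
    field_simp
  rw [h3]
  simp

theorem memLp_dilate {l : ℝ} (hl : 0 < l) {f : ℝ → ℝ} (hf : MemLp f 2 radialMeasure) :
    MemLp (dilate l f) 2 radialMeasure :=
  ⟨(aestronglyMeasurable_comp_mul hl hf.1).const_mul l, by rw [eLpNorm_dilate hl]; exact hf.2⟩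

theorem integral_dilate_mul {l : ℝ} (hl : 0 < l) (f h : ℝ → ℝ) :
    ∫ r, dilate l f r * h r ∂radialMeasure = ∫ r, f r * dilate l⁻¹ h r ∂radialMeasure := by
  have h1 := (measurableEmbedding_mul_left hl).integral_map (μ := radialMeasure)
    (fun s => f s * dilate l⁻¹ h s)
  rw [map_mul_left_radialMeasure hl, integral_smul_measure,
    ENNReal.toReal_ofReal (by positivity)] at h1
  have h2 : ∀ r, dilate l f r * h r = l ^ 2 * (f (l * r) * dilate l⁻¹ h (l * r)) := by
    intro r
    simp only [dilate]
    rw [inv_mul_cancel_left₀ hl.ne']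
    field_simp
  simp_rw [h2]
  rw [integral_const_mul, ← h1, smul_eq_mul]
  field_simp

/-- The dilate of `f` as an element of `L²`, with the value `0` for scales `l ≤ 0`. -/
noncomputable def dilateLp {f : ℝ → ℝ} (hf : MemLp f 2 radialMeasure) (l : ℝ) :
    Lp ℝ 2 radialMeasure :=
  if h : 0 < l then (memLp_dilate h hf).toLp else 0

theorem dilateLp_of_pos {f : ℝ → ℝ} (hf : MemLp f 2 radialMeasure) {l : ℝ} (hl : 0 < l) :
    dilateLp hf l = (memLp_dilate hl hf).toLp := dif_pos hl

theorem coeFn_dilateLp {f : ℝ → ℝ} (hf : MemLp f 2 radialMeasure) {l : ℝ} (hl : 0 < l) :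
    dilateLp hf l =ᵐ[radialMeasure] dilate l f := by
  rw [dilateLp_of_pos hf hl]
  exact MemLp.coeFn_toLp _

theorem dilateLp_one {f : ℝ → ℝ} (hf : MemLp f 2 radialMeasure) : dilateLp hf 1 = hf.toLp := by
  rw [dilateLp_of_pos hf one_pos]
  congr 1
  ext r
  simp [dilate]

theorem norm_dilateLp {f : ℝ → ℝ} (hf : MemLp f 2 radialMeasure) {l : ℝ} (hl : 0 < l) :
    ‖dilateLp hf l‖ = ‖hf.toLp‖ := by
  rw [dilateLp_of_pos hf hl, Lp.norm_toLp, Lp.norm_toLp, eLpNorm_dilate hl]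

theorem inner_toLp {f h : ℝ → ℝ} (hf : MemLp f 2 radialMeasure) (hh : MemLp h 2 radialMeasure) :
    ⟪hf.toLp, hh.toLp⟫ = ∫ r, f r * h r ∂radialMeasure := by
  rw [L2.inner_def]
  refine integral_congr_ae ?_
  filter_upwards [hf.coeFn_toLp, hh.coeFn_toLp] with r h1 h2
  simp [h1, h2, mul_comm]

theorem inner_dilateLp {f h : ℝ → ℝ} (hf : MemLp f 2 radialMeasure)
    (hh : MemLp h 2 radialMeasure) {l : ℝ} (hl : 0 < l) :
    ⟪dilateLp hf l, hh.toLp⟫ = ⟪hf.toLp, dilateLp hh l⁻¹⟫ := by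
  rw [dilateLp_of_pos hf hl, dilateLp_of_pos hh (inv_pos.2 hl), inner_toLp, inner_toLp,
    integral_dilate_mul hl]

theorem continuousOn_dilateLp {f : ℝ → ℝ} (hf : MemLp f 2 radialMeasure)
    (hfc : ContinuousOn f (Ioi 0)) : ContinuousOn (dilateLp hf) (Ioi 0) := by
  intro l₀ hl₀
  refine tendsto_Lp_of_ae_tendsto_of_norm_le (f := fun l => dilate l f) (B := fun _ => ‖hf.toLp‖)
    ?_ ?_ ?_ ?_
  · filter_upwards [self_mem_nhdsWithin] with l hl using coeFn_dilateLp hf hl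
  · filter_upwards [coeFn_dilateLp hf hl₀, ae_radialMeasure_pos] with r h1 hr
    rw [h1]
    have h2 : ContinuousOn (fun l => dilate l f r) (Ioi 0) :=
      continuousOn_id.mul (hfc.comp (by fun_prop) fun l hl => mul_pos hl hr)
    exact h2 l₀ hl₀
  · rw [norm_dilateLp hf hl₀]
    exact tendsto_const_nhds
  · filter_upwards [self_mem_nhdsWithin] with l hl using (norm_dilateLp hf hl).le

/-- Weak continuity of dilations: the continuity is moved to the continuous profile `h`. -/
theorem continuousOn_inner_dilateLp {f h : ℝ → ℝ} (hf : MemLp f 2 radialMeasure)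
    (hh : MemLp h 2 radialMeasure) (hhc : ContinuousOn h (Ioi 0)) :
    ContinuousOn (fun l => ⟪dilateLp hf l, hh.toLp⟫) (Ioi 0) := by
  have h1 : ContinuousOn (fun l : ℝ => ⟪hf.toLp, dilateLp hh l⁻¹⟫) (Ioi 0) := by
    refine continuousOn_const.inner ((continuousOn_dilateLp hh hhc).comp ?_ ?_)
    · exact continuousOn_inv₀.mono fun l hl => ne_of_gt hl
    · intro l hl
      exact inv_pos.2 (mem_Ioi.1 hl)
  exact h1.congr fun l hl => inner_dilateLp hf hh hl

/-! ### Differentiability of the scaling orbit -/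

theorem hasDerivAt_dilate {Q : ℝ → ℝ} (hQ : DifferentiableOn ℝ Q (Ioi 0)) {r l : ℝ} (hr : 0 < r)
    (hl : 0 < l) : HasDerivAt (fun l => dilate l Q r) (scalingGen Q (l * r)) l := by
  have h1 : HasDerivAt Q (deriv Q (l * r)) (l * r) :=
    ((hQ _ (mul_pos hl hr)).differentiableAt (Ioi_mem_nhds (mul_pos hl hr))).hasDerivAt
  have h2 : HasDerivAt (fun l => Q (l * r)) (deriv Q (l * r) * r) l := by
    simpa [Function.comp_def] using
      HasDerivAt.comp (h₂ := Q) (h := fun l => l * r) l h1 ((hasDerivAt_id l).mul_const r)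
  have h3 := (hasDerivAt_id l).mul h2
  refine h3.congr_deriv ?_
  simp only [scalingGen, id]
  ring

/-- The Cauchy-Schwarz inequality for `∫ ΛQ(t r) dt`, `t` between `1` and `l`. -/
theorem enorm_dilate_sub_sq_le {Q : ℝ → ℝ} (hQ : DifferentiableOn ℝ Q (Ioi 0))
    (hQc : ContinuousOn (scalingGen Q) (Ioi 0)) {r l : ℝ} (hr : 0 < r) (hl : 0 < l) :
    ‖dilate l Q r - dilate 1 Q r‖ₑ ^ 2
      ≤ ENNReal.ofReal |l - 1| * ∫⁻ t in uIoc 1 l, ‖scalingGen Q (t * r)‖ₑ ^ 2 := by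
  have hpos : ∀ t ∈ uIcc 1 l, 0 < t := fun t ht =>
    lt_of_lt_of_le (lt_min one_pos hl) ht.1
  have hc : ContinuousOn (fun t => scalingGen Q (t * r)) (uIcc 1 l) :=
    hQc.comp (by fun_prop) fun t ht => mul_pos (hpos t ht) hr
  have h1 := intervalIntegral.integral_eq_sub_of_hasDerivAt
    (fun t ht => hasDerivAt_dilate hQ hr (hpos t ht)) hc.intervalIntegrable
  have hm : AEMeasurable (fun t => ‖scalingGen Q (t * r)‖ₑ) (volume.restrict (uIoc 1 l)) :=
    ((hc.mono uIoc_subset_uIcc).aestronglyMeasurable measurableSet_uIoc).enorm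
  have h2 := sq_lintegral_le _ hm
  rw [Measure.restrict_apply_univ, uIoc, Real.volume_Ioc, max_sub_min_eq_abs] at h2
  rw [← h1]
  refine le_trans (pow_le_pow_left₀ zero_le ?_ 2) h2
  rw [← ofReal_norm, intervalIntegral.norm_intervalIntegral_eq, ofReal_norm]
  exact enorm_integral_le_lintegral_enorm _

theorem eLpNorm_sq {β : Type*} [NormedAddCommGroup β] {f : ℝ → β} :
    eLpNorm f 2 radialMeasure ^ 2 = ∫⁻ r, ‖f r‖ₑ ^ 2 ∂radialMeasure := by
  rw [eLpNorm_eq_lintegral_rpow_enorm_toReal two_ne_zero (by norm_num), ← ENNReal.rpow_natCast,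
    ← ENNReal.rpow_mul]
  simp

theorem lintegral_comp_mul_sq {f : ℝ → ℝ} {l : ℝ} (hl : 0 < l) :
    ∫⁻ r, ‖f (l * r)‖ₑ ^ 2 ∂radialMeasure
      = ENNReal.ofReal (l⁻¹ ^ 2) * eLpNorm f 2 radialMeasure ^ 2 := by
  rw [eLpNorm_sq, ← smul_eq_mul, ← lintegral_smul_measure, ← map_mul_left_radialMeasure hl,
    (measurableEmbedding_mul_left hl).lintegral_map]

/-- The difference quotients of `l ↦ l Q(l ·)` at `1` are bounded in `L²` by `‖ΛQ‖ / min 1 l`. -/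
theorem eLpNorm_dilate_sub_le {Q : ℝ → ℝ} (hQ : DifferentiableOn ℝ Q (Ioi 0))
    (hQc : ContinuousOn (scalingGen Q) (Ioi 0)) {l : ℝ} (hl : 0 < l) :
    eLpNorm (fun r => dilate l Q r - dilate 1 Q r) 2 radialMeasure
      ≤ ENNReal.ofReal (|l - 1| * (min 1 l)⁻¹) * eLpNorm (scalingGen Q) 2 radialMeasure := by
  have hm0 : 0 < min 1 l := lt_min one_pos hl
  have hae : scalingGen Q =ᵐ[radialMeasure] (Ioi 0).indicator (scalingGen Q) := by
    filter_upwards [ae_radialMeasure_pos] with r hr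
    rw [indicator_of_mem (mem_Ioi.2 hr)]
  have hmeas : Measurable ((Ioi 0).indicator (scalingGen Q)) := by
    classical
    rw [← piecewise_eq_indicator]
    exact hQc.measurable_piecewise continuousOn_const measurableSet_Ioi
  -- `scalingGen Q` need not be measurable on the negative half-line; its cutoff `L` is.
  set L := (Ioi 0).indicator (scalingGen Q) with hL
  refine (ENNReal.pow_le_pow_left_iff two_ne_zero).1 ?_
  rw [mul_pow, eLpNorm_sq, eLpNorm_congr_ae hae]
  calc ∫⁻ r, ‖dilate l Q r - dilate 1 Q r‖ₑ ^ 2 ∂radialMeasure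
      ≤ ∫⁻ r, (ENNReal.ofReal |l - 1| * ∫⁻ t in uIoc 1 l, ‖L (t * r)‖ₑ ^ 2) ∂radialMeasure := by
        refine lintegral_mono_ae ?_
        filter_upwards [ae_radialMeasure_pos] with r hr
        refine (enorm_dilate_sub_sq_le hQ hQc hr hl).trans (le_of_eq ?_)
        congr 1
        refine setLIntegral_congr_fun measurableSet_uIoc fun t ht => ?_
        have : 0 < t * r := mul_pos (hm0.trans ht.1) hr
        simp only [hL, indicator_of_mem (mem_Ioi.2 this)]
    _ = ENNReal.ofReal |l - 1| * ∫⁻ t in uIoc 1 l, (∫⁻ r, ‖L (t * r)‖ₑ ^ 2 ∂radialMeasure) := by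
        have hmm : Measurable fun x : ℝ × ℝ => ‖L (x.2 * x.1)‖ₑ ^ 2 :=
          ((hmeas.comp (measurable_snd.mul measurable_fst)).enorm).pow_const 2
        rw [lintegral_const_mul _ hmm.lintegral_prod_right',
          lintegral_lintegral_swap hmm.aemeasurable]
    _ ≤ ENNReal.ofReal |l - 1| * ∫⁻ _ in uIoc 1 l,
          ENNReal.ofReal ((min 1 l)⁻¹ ^ 2) * eLpNorm L 2 radialMeasure ^ 2 := by
        refine mul_le_mul_right ?_ _
        refine setLIntegral_mono' measurableSet_uIoc fun t ht => ?_
        have htm : min 1 l < t := ht.1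
        have ht0 : 0 ≤ t⁻¹ := (inv_pos.2 (hm0.trans htm)).le
        rw [lintegral_comp_mul_sq (hm0.trans htm)]
        gcongr
    _ = _ := by
        rw [lintegral_const, Measure.restrict_apply_univ, uIoc, Real.volume_Ioc,
          max_sub_min_eq_abs, mul_comm (_ * _) (ENNReal.ofReal _), ← mul_assoc,
          ← mul_assoc, ← ENNReal.ofReal_mul (by positivity), ← ENNReal.ofReal_mul (by positivity),
          ← ENNReal.ofReal_pow (by positivity)]
        congr 2
        ring

theorem hasDerivAt_dilateLp {Q : ℝ → ℝ} (hQ : DifferentiableOn ℝ Q (Ioi 0))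
    (hQc : ContinuousOn (scalingGen Q) (Ioi 0)) (hQ2 : MemLp Q 2 radialMeasure)
    (hΛ : MemLp (scalingGen Q) 2 radialMeasure) :
    HasDerivAt (dilateLp hQ2) hΛ.toLp 1 := by
  rw [hasDerivAt_iff_tendsto_slope]
  have hev : ∀ᶠ l : ℝ in 𝓝[≠] 1, 0 < l := nhdsWithin_le_nhds (Ioi_mem_nhds one_pos)
  have hsub : ∀ {l : ℝ}, 0 < l → (dilateLp hQ2 l - dilateLp hQ2 1 : Lp ℝ 2 radialMeasure)
      =ᵐ[radialMeasure] fun r => dilate l Q r - dilate 1 Q r := by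
    intro l hl
    filter_upwards [Lp.coeFn_sub (dilateLp hQ2 l) (dilateLp hQ2 1), coeFn_dilateLp hQ2 hl,
      coeFn_dilateLp hQ2 one_pos] with r h1 h2 h3
    rw [h1, Pi.sub_apply, h2, h3]
  refine tendsto_Lp_of_ae_tendsto_of_norm_le
    (f := fun l r => slope (fun l => dilate l Q r) 1 l)
    (B := fun l => (min 1 l)⁻¹ * ‖hΛ.toLp‖) ?_ ?_ ?_ ?_
  · filter_upwards [hev] with l hl
    filter_upwards [hsub hl, Lp.coeFn_smul (l - 1)⁻¹ (dilateLp hQ2 l - dilateLp hQ2 1)]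
      with r h1 h2
    simp only [slope, vsub_eq_sub]
    rw [h2, Pi.smul_apply, h1]
  · filter_upwards [hΛ.coeFn_toLp, ae_radialMeasure_pos] with r h1 hr
    rw [h1]
    have := hasDerivAt_iff_tendsto_slope.1 (hasDerivAt_dilate hQ hr one_pos)
    rwa [one_mul] at this
  · have h1 : Tendsto (fun l : ℝ => (min 1 l)⁻¹ * ‖hΛ.toLp‖) (𝓝 1)
        (𝓝 ((min 1 1)⁻¹ * ‖hΛ.toLp‖)) :=
      ((tendsto_const_nhds.min tendsto_id).inv₀ (by simp)).mul_const _
    simp only [min_self, inv_one, one_mul] at h1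
    exact h1.mono_left nhdsWithin_le_nhds
  · filter_upwards [hev, self_mem_nhdsWithin] with l hl hl1
    have hl1' : 0 < |l - 1| := abs_pos.2 (sub_ne_zero.2 hl1)
    have hm0 : 0 < min 1 l := lt_min one_pos hl
    have h1 : ‖dilateLp hQ2 l - dilateLp hQ2 1‖ ≤ |l - 1| * (min 1 l)⁻¹ * ‖hΛ.toLp‖ := by
      rw [Lp.norm_def, eLpNorm_congr_ae (hsub hl), Lp.norm_toLp]
      have h2 := ENNReal.toReal_mono (ENNReal.mul_ne_top ENNReal.ofReal_ne_top hΛ.2.ne)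
        (eLpNorm_dilate_sub_le hQ hQc hl)
      rwa [ENNReal.toReal_mul, ENNReal.toReal_ofReal (by positivity)] at h2
    rw [slope, vsub_eq_sub, norm_smul, norm_inv, Real.norm_eq_abs, inv_mul_le_iff₀ hl1',
      ← mul_assoc]
    exact h1

/-! ### Decay of the standing wave -/

theorem integrable_radialMeasure_iff {f : ℝ → ℝ} :
    Integrable f radialMeasure ↔ IntegrableOn (fun r => r * f r) (Ioi 0) := by
  rw [radialMeasure, integrable_withDensity_iff_integrable_smul' (by fun_prop) (by simp),
    IntegrableOn]
  refine Iff.trans (integrable_congr ?_)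
    (integrable_const_mul_iff (c := 2 * Real.pi) (by simp [Real.pi_ne_zero]) _)
  filter_upwards [ae_restrict_mem measurableSet_Ioi] with r hr
  have hr' : (0 : ℝ) < r := hr
  rw [ENNReal.toReal_ofReal (by positivity), smul_eq_mul]
  ring

/-- A radial function in `H¹` tends to `0` at infinity, because `f²` and `(f²)'` are integrable on
`(1, ∞)`. -/
theorem tendsto_zero_of_memLp_deriv {f : ℝ → ℝ} (hf : DifferentiableOn ℝ f (Ioi 0))
    (hf' : ContinuousOn (deriv f) (Ioi 0)) (h2 : MemLp f 2 radialMeasure)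
    (h2' : MemLp (deriv f) 2 radialMeasure) : Tendsto f atTop (𝓝 0) := by
  have hsub : Ioi (1 : ℝ) ⊆ Ioi 0 := Ioi_subset_Ioi zero_le_one
  have key : ∀ {g : ℝ → ℝ}, ContinuousOn g (Ioi 0) → MemLp g 2 radialMeasure →
      IntegrableOn (fun r => g r ^ 2) (Ioi 1) := by
    intro g hg hg2
    have h1 := (integrable_radialMeasure_iff.1 hg2.integrable_sq).mono_set hsub
    refine Integrable.mono' h1
      (((hg.mono hsub).pow 2).aestronglyMeasurable measurableSet_Ioi) ?_
    filter_upwards [ae_restrict_mem measurableSet_Ioi] with r hr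
    have hr' : (1 : ℝ) < r := hr
    rw [Real.norm_eq_abs, abs_of_nonneg (by positivity)]
    nlinarith [sq_nonneg (g r)]
  have i1 := key hf.continuousOn h2
  have i2 := key hf' h2'
  have hder : ∀ r ∈ Ioi (1 : ℝ), HasDerivAt (fun r => f r ^ 2) (2 * f r * deriv f r) r := by
    intro r hr
    have h1 := ((hf r (hsub hr)).differentiableAt (Ioi_mem_nhds (hsub hr))).hasDerivAt
    simpa using h1.fun_pow 2
  have i3 : IntegrableOn (fun r => 2 * f r * deriv f r) (Ioi 1) := by
    refine Integrable.mono' (i1.add i2)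
      (((continuousOn_const.mul hf.continuousOn).mul hf').mono hsub |>.aestronglyMeasurable
        measurableSet_Ioi) (Eventually.of_forall fun r => ?_)
    rw [Real.norm_eq_abs, Pi.add_apply, abs_le]
    constructor <;> nlinarith [sq_nonneg (f r + deriv f r), sq_nonneg (f r - deriv f r)]
  have hlim := tendsto_zero_of_hasDerivAt_of_integrableOn_Ioi hder i3 i1
  rw [tendsto_zero_iff_abs_tendsto_zero]
  have := (Real.continuous_sqrt.tendsto 0).comp hlim
  simpa [Function.comp_def, Real.sqrt_sq_eq_abs] using this

section Potential

variable {Q : ℝ → ℝ}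

theorem integrableOn_sq_mul (hQ : MemLp Q 2 radialMeasure) :
    IntegrableOn (fun s => Q s ^ 2 * s) (Ioi 0) :=
  (integrable_radialMeasure_iff.1 hQ.integrable_sq).congr_fun (fun _ _ => mul_comm _ _)
    measurableSet_Ioi

theorem setIntegral_sq_mul_le (hQ : MemLp Q 2 radialMeasure) {t : Set ℝ} (ht : t ⊆ Ioi 0) :
    ∫ s in t, Q s ^ 2 * s ≤ ∫ s in Ioi 0, Q s ^ 2 * s := by
  refine setIntegral_mono_set (integrableOn_sq_mul hQ) ?_ ht.eventuallyLE
  filter_upwards [ae_restrict_mem measurableSet_Ioi] with s hs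
  have hs' : (0 : ℝ) < s := hs
  simp only [Pi.zero_apply]
  positivity

theorem abs_Atheta_le (hQ : MemLp Q 2 radialMeasure) {r : ℝ} (hr : 0 ≤ r) :
    |Atheta Q r| ≤ ∫ s in Ioi 0, Q s ^ 2 * s := by
  have h1 := setIntegral_sq_mul_le hQ (t := Ioc 0 r) Ioc_subset_Ioi_self
  have h2 : 0 ≤ ∫ s in Ioc 0 r, Q s ^ 2 * s :=
    setIntegral_nonneg measurableSet_Ioc fun s hs => mul_nonneg (sq_nonneg _) hs.1.le
  rw [Atheta, intervalIntegral.integral_of_le hr, abs_mul, abs_of_nonneg h2]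
  norm_num
  linarith

/-- No integrability of the integrand of `A_0` is needed, as it is dominated by a multiple of
`Q² s` on `(r, ∞)`. -/
theorem abs_Azero_le (m : ℕ) (hQ : MemLp Q 2 radialMeasure) {r : ℝ} (hr : 0 < r) :
    |Azero m Q r| ≤ (m + ∫ s in Ioi 0, Q s ^ 2 * s) * (∫ s in Ioi 0, Q s ^ 2 * s) / r ^ 2 := by
  set J := ∫ s in Ioi 0, Q s ^ 2 * s with hJ
  have hJ0 : 0 ≤ J := setIntegral_nonneg measurableSet_Ioi fun s hs =>
    mul_nonneg (sq_nonneg _) (le_of_lt hs)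
  have hsub : Ioi r ⊆ Ioi 0 := Ioi_subset_Ioi hr.le
  have h1 : ‖∫ s in Ioi r, ((m : ℝ) + Atheta Q s) * Q s ^ 2 / s‖
      ≤ ∫ s in Ioi r, (m + J) / r ^ 2 * (Q s ^ 2 * s) := by
    refine norm_integral_le_of_norm_le
      (((integrableOn_sq_mul hQ).mono_set hsub).const_mul _) ?_
    filter_upwards [ae_restrict_mem measurableSet_Ioi] with s hs
    have hrs : r < s := hs
    have hs0 : 0 < s := hr.trans hrs
    have h2 := abs_Atheta_le hQ hs0.le
    rw [Real.norm_eq_abs, abs_div, abs_mul, abs_of_pos hs0, abs_of_nonneg (sq_nonneg (Q s))]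
    have h3 : |(m : ℝ) + Atheta Q s| ≤ m + J :=
      (abs_add_le _ _).trans (by rw [Nat.abs_cast]; linarith)
    calc |(m : ℝ) + Atheta Q s| * Q s ^ 2 / s ≤ (m + J) * Q s ^ 2 / s := by gcongr
      _ = (m + J) / s ^ 2 * (Q s ^ 2 * s) := by field_simp
      _ ≤ (m + J) / r ^ 2 * (Q s ^ 2 * s) := by gcongr
  rw [integral_const_mul] at h1
  rw [Azero, abs_neg, ← Real.norm_eq_abs]
  refine h1.trans ?_
  rw [div_mul_eq_mul_div]
  gcongr
  exact setIntegral_sq_mul_le hQ hsub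

theorem tendsto_Azero (m : ℕ) (hQ : MemLp Q 2 radialMeasure) :
    Tendsto (Azero m Q) atTop (𝓝 0) := by
  refine squeeze_zero_norm' ?_
    ((tendsto_pow_atTop (two_ne_zero)).const_div_atTop
      ((m + ∫ s in Ioi 0, Q s ^ 2 * s) * (∫ s in Ioi 0, Q s ^ 2 * s)))
  filter_upwards [eventually_gt_atTop 0] with r hr using abs_Azero_le m hQ hr

end Potential

/-- If `Q > 0` tends to `0` and `P = r Q'` satisfies `P' ≥ c r Q` for `r ≥ R`, then `P = O(r⁻²)`.
Indeed `P` is increasing and nonpositive and `Q` is decreasing, so that the mean value theorem on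
`[r / 2, r]` gives `c r² Q(r) / 4 ≤ -P(r / 2) ≤ -P(R)` and `-P(r) ≤ 2 Q(r / 2)`. -/
theorem exists_deriv_decay {Q Q' : ℝ → ℝ} {c R : ℝ} (hc : 0 < c) (hR : 0 < R)
    (hpos : ∀ r, R ≤ r → 0 < Q r) (hlim : Tendsto Q atTop (𝓝 0))
    (hQ : ∀ r, R ≤ r → HasDerivAt Q (Q' r) r)
    (hP : ∀ r, R ≤ r → ∃ D, c * r * Q r ≤ D ∧ HasDerivAt (fun r => r * Q' r) D r) :
    ∃ C S, 0 < S ∧ ∀ r, S < r → |r * Q' r| ≤ C / r ^ 2 := by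
  have hPc : ContinuousOn (fun r => r * Q' r) (Ici R) := fun r hr =>
    let ⟨_, _, h⟩ := hP r hr
    h.continuousAt.continuousWithinAt
  have hQc : ContinuousOn Q (Ici R) := fun r hr => (hQ r hr).continuousAt.continuousWithinAt
  have hmono : MonotoneOn (fun r => r * Q' r) (Ici R) := by
    refine monotoneOn_of_deriv_nonneg (convex_Ici R) hPc ?_ ?_
    · intro r hr
      rw [interior_Ici] at hr
      obtain ⟨_, _, h⟩ := hP r (le_of_lt hr)
      exact h.differentiableAt.differentiableWithinAt
    · intro r hr
      rw [interior_Ici] at hr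
      have hr' : R < r := hr
      obtain ⟨D, hD, h⟩ := hP r hr'.le
      rw [h.deriv]
      have := hpos r hr'.le
      have hr0 : 0 < r := hR.trans hr'
      exact le_trans (by positivity) hD
  -- A positive value of `r Q'` would persist, and keep `Q` away from `0`.
  have hneg : ∀ r, R ≤ r → r * Q' r ≤ 0 := by
    intro r₀ hr₀
    by_contra! hcon
    have hinc : MonotoneOn Q (Ici r₀) := by
      refine monotoneOn_of_deriv_nonneg (convex_Ici r₀) (hQc.mono (Ici_subset_Ici.2 hr₀)) ?_ ?_
      · intro r hr
        rw [interior_Ici] at hr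
        exact (hQ r (hr₀.trans (le_of_lt hr))).differentiableAt.differentiableWithinAt
      · intro r hr
        rw [interior_Ici] at hr
        have hr' : r₀ < r := hr
        rw [(hQ r (hr₀.trans hr'.le)).deriv]
        have h1 := hmono (mem_Ici.2 hr₀) (mem_Ici.2 (hr₀.trans hr'.le)) hr'.le
        have h2 : 0 < r * Q' r := hcon.trans_le h1
        exact (pos_of_mul_pos_right h2 (by linarith : 0 ≤ r)).le
    have h1 : Q r₀ ≤ 0 := by
      refine ge_of_tendsto hlim ?_
      filter_upwards [eventually_ge_atTop r₀] with r hr using hinc self_mem_Ici hr hr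
    exact absurd (hpos r₀ hr₀) h1.not_gt
  have hanti : AntitoneOn Q (Ici R) := by
    refine antitoneOn_of_deriv_nonpos (convex_Ici R) hQc ?_ ?_
    · intro r hr
      rw [interior_Ici] at hr
      exact (hQ r (le_of_lt hr)).differentiableAt.differentiableWithinAt
    · intro r hr
      rw [interior_Ici] at hr
      have hr' : R < r := hr
      rw [(hQ r hr'.le).deriv]
      exact nonpos_of_mul_nonpos_right (hneg r hr'.le) (hR.trans hr')
  have hQdecay : ∀ r, 2 * R ≤ r → c * r ^ 2 / 4 * Q r ≤ -(R * Q' R) := by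
    intro r hr
    have hlt : r / 2 < r := by linarith
    have hRr : R ≤ r / 2 := by linarith
    obtain ⟨ξ, hξ, h1⟩ := exists_deriv_eq_slope (fun r => r * Q' r) hlt
      (hPc.mono fun x hx => hRr.trans hx.1) (fun x hx => by
        obtain ⟨_, _, h⟩ := hP x (hRr.trans hx.1.le)
        exact h.differentiableAt.differentiableWithinAt)
    have hRξ : R ≤ ξ := hRr.trans hξ.1.le
    obtain ⟨D, hD, h2⟩ := hP ξ hRξ
    rw [h2.deriv, eq_div_iff (by linarith)] at h1
    have h3 : Q r ≤ Q ξ := hanti (mem_Ici.2 hRξ) (mem_Ici.2 (by linarith)) hξ.2.le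
    have h4 : R * Q' R ≤ r / 2 * Q' (r / 2) := hmono self_mem_Ici (mem_Ici.2 hRr) hRr
    have h5 := hneg r (by linarith)
    have hQr := hpos r (by linarith)
    have h6 : c * (r / 2) * Q r ≤ D := by
      refine le_trans ?_ hD
      have : 0 < ξ := hR.trans_le hRξ
      gcongr
      exact hξ.1.le
    have h7 : c * (r / 2) * Q r * (r - r / 2) ≤ D * (r - r / 2) :=
      mul_le_mul_of_nonneg_right h6 (by linarith)
    linarith
  refine ⟨32 * -(R * Q' R) / c, 4 * R, by positivity, fun r hr => ?_⟩
  have hlt : r / 2 < r := by linarith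
  have hr0 : 0 < r := by linarith
  have hRr : 2 * R ≤ r / 2 := by linarith
  obtain ⟨ξ, hξ, h1⟩ := exists_deriv_eq_slope Q hlt
    (hQc.mono fun x hx => by have := hx.1; rw [mem_Ici]; linarith) (fun x hx =>
      (hQ x (by have := hx.1; linarith)).differentiableAt.differentiableWithinAt)
  have hξ1 := hξ.1
  have hξ2 := hξ.2
  have hRξ : R ≤ ξ := by linarith
  have hξ0 : 0 < ξ := by linarith
  rw [(hQ ξ hRξ).deriv, eq_div_iff (by linarith)] at h1
  have h2 : ξ * Q' ξ ≤ r * Q' r := hmono (mem_Ici.2 hRξ) (mem_Ici.2 (by linarith)) hξ2.le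
  have h3 := hpos r (by linarith)
  have h4 := hQdecay (r / 2) hRr
  have h5 : Q' ξ ≤ 0 := nonpos_of_mul_nonpos_right (hneg ξ hRξ) hξ0
  have h6 : r * Q' ξ ≤ r * Q' r := by nlinarith
  rw [abs_of_nonpos (hneg r (by linarith)), div_div, le_div_iff₀ (by positivity)]
  have h7 : -(r * Q' r) ≤ 2 * Q (r / 2) := by nlinarith
  calc -(r * Q' r) * (c * r ^ 2) ≤ 2 * Q (r / 2) * (c * r ^ 2) := by gcongr
    _ = 32 * (c * (r / 2) ^ 2 / 4 * Q (r / 2)) := by ring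
    _ ≤ _ := by linarith

theorem memLp_mul_of_decay {f : ℝ → ℝ} (hf : MemLp f 2 radialMeasure) {C S : ℝ} (hS : 0 < S)
    (hdecay : ∀ r, S < r → |r * f r| ≤ C / r ^ 2) :
    MemLp (fun r => r * f r) 2 radialMeasure := by
  have hmeas : AEStronglyMeasurable (fun r => r * f r) radialMeasure :=
    (continuous_id.aestronglyMeasurable).mul hf.1
  rw [memLp_two_iff_integrable_sq hmeas]
  have h1 : Integrable (fun r => S ^ 2 * f r ^ 2) radialMeasure := hf.integrable_sq.const_mul _
  have h2 : Integrable ((Ioi S).indicator fun r => C ^ 2 * r ^ (-4 : ℝ)) radialMeasure := by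
    rw [integrable_radialMeasure_iff]
    have h3 : (fun r => r * (Ioi S).indicator (fun r => C ^ 2 * r ^ (-4 : ℝ)) r)
        = (Ioi S).indicator fun r => C ^ 2 * r ^ (-3 : ℝ) := by
      ext r
      by_cases hr : r ∈ Ioi S
      · have hr0 : 0 < r := hS.trans hr
        rw [indicator_of_mem hr, indicator_of_mem hr, show (-3 : ℝ) = 1 + -4 by norm_num,
          Real.rpow_add hr0, Real.rpow_one]
        ring
      · simp [indicator_of_notMem hr]
    rw [h3]
    refine (IntegrableOn.integrable_indicator ?_ measurableSet_Ioi).integrableOn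
    exact (integrableOn_Ioi_rpow_of_lt (by norm_num) hS).const_mul _
  refine Integrable.mono' (h1.add h2) (hmeas.pow 2) ?_
  filter_upwards [ae_radialMeasure_pos] with r hr
  rw [Real.norm_eq_abs, abs_of_nonneg (by positivity), Pi.add_apply]
  by_cases hrS : r ∈ Ioi S
  · rw [indicator_of_mem hrS]
    have h4 := hdecay r hrS
    have h5 : (r * f r) ^ 2 ≤ (C / r ^ 2) ^ 2 := sq_le_sq.2 (h4.trans (le_abs_self _))
    have h6 : (C / r ^ 2) ^ 2 = C ^ 2 * r ^ (-4 : ℝ) := by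
      rw [show (-4 : ℝ) = -((4 : ℕ) : ℝ) by norm_num, Real.rpow_neg hr.le, Real.rpow_natCast]
      field_simp
    have h7 : 0 ≤ S ^ 2 * f r ^ 2 := by positivity
    linarith
  · rw [indicator_of_notMem hrS, add_zero, mul_pow]
    have : r ≤ S := not_lt.1 hrS
    gcongr

namespace IsSoliton

variable {m : ℕ} {g α : ℝ} {Q : ℝ → ℝ}

theorem contDiffOn_deriv (hQ : IsSoliton m g α Q) : ContDiffOn ℝ 1 (deriv Q) (Ioi 0) :=
  hQ.contDiffOn.deriv_of_isOpen isOpen_Ioi (by norm_num)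

theorem continuousOn_scalingGen (hQ : IsSoliton m g α Q) :
    ContinuousOn (scalingGen Q) (Ioi 0) :=
  hQ.contDiffOn.continuousOn.add (continuousOn_id.mul hQ.contDiffOn_deriv.continuousOn)

theorem exists_scalingDeriv_decay (hα : 0 < α) (hQ : IsSoliton m g α Q) :
    ∃ C S, 0 < S ∧ ∀ r, S < r → |r * deriv Q r| ≤ C / r ^ 2 := by
  have hlim := tendsto_zero_of_memLp_deriv hQ.memH1.differentiableOn
    hQ.contDiffOn_deriv.continuousOn hQ.memH1.memLp hQ.memH1.memLp_deriv
  have hW : Tendsto (fun r => Azero m Q r - g * Q r ^ 2 + α) atTop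
      (𝓝 (0 - g * 0 ^ 2 + α)) :=
    ((tendsto_Azero m hQ.memH1.memLp).sub ((hlim.pow 2).const_mul g)).add_const α
  obtain ⟨R, hR⟩ := eventually_atTop.1
    (hW.eventually_const_le (u := α / 2) (by simp; linarith))
  have hmax : ∀ {r : ℝ}, max R 1 ≤ r → 0 < r := fun h =>
    one_pos.trans_le ((le_max_right _ _).trans h)
  refine exists_deriv_decay (half_pos hα) (R := max R 1) (by positivity)
    (fun r hr => hQ.pos r (hmax hr)) hlim (fun r hr => ?_) (fun r hr => ?_)
  · exact ((hQ.memH1.differentiableOn r (hmax hr)).differentiableAt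
      (Ioi_mem_nhds (hmax hr))).hasDerivAt
  · have hr0 : 0 < r := hmax hr
    have h1 : HasDerivAt (deriv Q) (deriv (deriv Q) r) r :=
      ((hQ.contDiffOn_deriv.differentiableOn one_ne_zero r hr0).differentiableAt
        (Ioi_mem_nhds hr0)).hasDerivAt
    refine ⟨_, ?_, (hasDerivAt_id r).mul h1⟩
    have heq := hQ.equation r hr0
    have hW := hR r ((le_max_left _ _).trans hr)
    have hQr := hQ.pos r hr0
    -- The centrifugal terms combine to the square `(m + A_θ)² / r²`.
    have h2 : 1 * deriv Q r + id r * deriv (deriv Q) r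
        = r * Q r * ((m + Atheta Q r) ^ 2 / r ^ 2 + (Azero m Q r - g * Q r ^ 2 + α)) := by
      have h3 : r * deriv (deriv Q) r + deriv Q r = r * (deriv (deriv Q) r + deriv Q r / r) := by
        field_simp
      simp only [id, one_mul]
      rw [add_comm, h3]
      have h4 : deriv (deriv Q) r + deriv Q r / r
          = Q r * ((m + Atheta Q r) ^ 2 / r ^ 2 + (Azero m Q r - g * Q r ^ 2 + α)) := by
        linear_combination heq
      rw [h4]
      ring
    rw [h2]
    have h5 : 0 ≤ (m + Atheta Q r) ^ 2 / r ^ 2 := by positivity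
    calc α / 2 * r * Q r = r * Q r * (α / 2) := by ring
      _ ≤ _ := by gcongr; linarith

theorem memLp_scalingGen (hα : 0 < α) (hQ : IsSoliton m g α Q) :
    MemLp (scalingGen Q) 2 radialMeasure := by
  obtain ⟨C, S, hS, h⟩ := hQ.exists_scalingDeriv_decay hα
  exact hQ.memH1.memLp.add
    (memLp_mul_of_decay hQ.memH1.memLp_deriv hS h)

end IsSoliton

/-! ### Complex profiles and their real and imaginary parts -/

theorem l2Norm_eq_norm_toLp {f : ℝ → ℝ} (hf : MemLp f 2 radialMeasure) :
    l2Norm f = ‖hf.toLp‖ := (Lp.norm_toLp f hf).symm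

theorem inner_toLp_right {Y : Lp ℝ 2 radialMeasure} {f h : ℝ → ℝ}
    (hY : Y =ᵐ[radialMeasure] f) (hh : MemLp h 2 radialMeasure) :
    ⟪Y, hh.toLp⟫ = ∫ r, f r * h r ∂radialMeasure := by
  rw [L2.inner_def]
  refine integral_congr_ae ?_
  filter_upwards [hY, hh.coeFn_toLp] with r h1 h2
  simp [h1, h2, mul_comm]

theorem l2Inner_toC_right (w : ℝ → ℂ) (h : ℝ → ℝ) :
    l2Inner w (toC h) = ∫ r, (w r).re * h r ∂radialMeasure := by
  simp [l2Inner, toC]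

theorem l2Inner_I_mul_toC_right (w : ℝ → ℂ) (h : ℝ → ℝ) :
    l2Inner w (fun r => Complex.I * toC h r) = ∫ r, (w r).im * h r ∂radialMeasure := by
  simp [l2Inner, toC]

theorem l2Inner_toC_toC {f h : ℝ → ℝ} (hf : MemLp f 2 radialMeasure)
    (hh : MemLp h 2 radialMeasure) : l2Inner (toC f) (toC h) = ⟪hf.toLp, hh.toLp⟫ := by
  rw [l2Inner_toC_right, inner_toLp]
  simp [toC]

theorem eLpNorm_sq_eq_of_re_im {w : ℝ → ℂ} {Y₁ Y₂ : Lp ℝ 2 radialMeasure}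
    (h₁ : Y₁ =ᵐ[radialMeasure] fun r => (w r).re) (h₂ : Y₂ =ᵐ[radialMeasure] fun r => (w r).im) :
    eLpNorm w 2 radialMeasure ^ 2 = ENNReal.ofReal (‖Y₁‖ ^ 2 + ‖Y₂‖ ^ 2) := by
  have key : ∀ Y : Lp ℝ 2 radialMeasure,
      ENNReal.ofReal (‖Y‖ ^ 2) = ∫⁻ r, ‖Y r‖ₑ ^ 2 ∂radialMeasure := by
    intro Y
    rw [ENNReal.ofReal_pow (norm_nonneg _), Lp.norm_def,
      ENNReal.ofReal_toReal (Lp.eLpNorm_ne_top _), eLpNorm_sq]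
  rw [ENNReal.ofReal_add (by positivity) (by positivity), key, key, eLpNorm_sq,
    ← lintegral_add_left' ((Lp.aestronglyMeasurable Y₁).enorm.pow_const 2)]
  refine lintegral_congr_ae ?_
  filter_upwards [h₁, h₂] with r h1 h2
  rw [h1, h2, ← ofReal_norm, ← ofReal_norm, ← ofReal_norm, ← ENNReal.ofReal_pow (norm_nonneg _),
    ← ENNReal.ofReal_pow (norm_nonneg _), ← ENNReal.ofReal_pow (norm_nonneg _),
    ← ENNReal.ofReal_add (by positivity) (by positivity), ← Complex.normSq_eq_norm_sq,
    Complex.normSq_apply]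
  congr 1
  simp only [Real.norm_eq_abs, sq_abs]
  ring

/-- A further phase `σ` and scale `μ` act on the decomposition `v = Q + ε₀` obtained with the
initial parameters. -/
theorem remainder_add_mul (Q : ℝ → ℝ) (γ₀ l₀ σ μ : ℝ) (v : ℝ → ℂ) (r : ℝ) :
    remainder Q (γ₀ + σ) (l₀ * μ) v r
      = Complex.exp (σ * Complex.I)
          * ((dilate μ Q r : ℂ) + μ * remainder Q γ₀ l₀ v (μ * r)) - Q r := by
  simp only [remainder, modulate, toC, dilate]
  push_cast
  rw [show Complex.I * ((γ₀ : ℂ) + σ) = Complex.I * γ₀ + σ * Complex.I by ring, Complex.exp_add,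
    mul_assoc l₀ μ r]
  ring

theorem aestronglyMeasurable_remainder {Q : ℝ → ℝ} (hQ : MemLp Q 2 radialMeasure) (γ : ℝ) {l : ℝ}
    (hl : 0 < l) {v : ℝ → ℂ} (hv : MemLp v 2 radialMeasure) :
    AEStronglyMeasurable (remainder Q γ l v) radialMeasure :=
  ((aestronglyMeasurable_comp_mul hl hv.1).const_mul _).sub
    (Complex.continuous_ofReal.comp_aestronglyMeasurable hQ.1)

/-! ### Modulation of a single profile -/

/-- Modulation at a fixed time, for a real profile `Q` whose scaling generator lies in `L²`. -/
theorem exists_modulation_of_remainder_le {Q ψ : ℝ → ℝ} (hQ : DifferentiableOn ℝ Q (Ioi 0))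
    (hQc : ContinuousOn (scalingGen Q) (Ioi 0)) (hQ2 : MemLp Q 2 radialMeasure)
    (hΛ : MemLp (scalingGen Q) 2 radialMeasure) (hψ : MemLp ψ 2 radialMeasure)
    (hψc : ContinuousOn ψ (Ioi 0)) (hscale : l2Inner (toC (scalingGen Q)) (toC ψ) ≠ 0)
    (hphase : l2Inner (toC Q) (toC ψ) ≠ 0) {K : ℝ}
    (hK : max (l2Norm Q * l2Norm ψ / |l2Inner (toC Q) (toC ψ)|)
      (l2Norm (scalingGen Q) * l2Norm ψ / |l2Inner (toC (scalingGen Q)) (toC ψ)|) < K) :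
    ∃ η C : ℝ, 0 < η ∧ 0 < C ∧ ∀ (v : ℝ → ℂ) (γ₀ l₀ : ℝ), MemLp v 2 radialMeasure → 0 < l₀ →
      eLpNorm (remainder Q γ₀ l₀ v) 2 radialMeasure ≤ ENNReal.ofReal η →
      ∃ γ l : ℝ, 0 < l ∧
        eLpNorm (remainder Q γ l v) 2 radialMeasure
          ≤ ENNReal.ofReal K * eLpNorm (remainder Q γ₀ l₀ v) 2 radialMeasure ∧
        l2Inner (remainder Q γ l v) (toC ψ) = 0 ∧
        l2Inner (remainder Q γ l v) (fun r => Complex.I * toC ψ r) = 0 ∧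
        ENNReal.ofReal (|γ - γ₀| + |l / l₀ - 1|)
          ≤ ENNReal.ofReal C * eLpNorm (remainder Q γ₀ l₀ v) 2 radialMeasure := by
  have hK0 : 0 ≤ K := le_trans (le_max_of_le_left
    (div_nonneg (mul_nonneg ENNReal.toReal_nonneg ENNReal.toReal_nonneg) (abs_nonneg _))) hK.le
  rw [l2Norm_eq_norm_toLp hQ2, l2Norm_eq_norm_toLp hψ, l2Norm_eq_norm_toLp hΛ,
    l2Inner_toC_toC hQ2 hψ, l2Inner_toC_toC hΛ hψ] at hK
  rw [l2Inner_toC_toC hΛ hψ] at hscale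
  rw [l2Inner_toC_toC hQ2 hψ] at hphase
  rw [← dilateLp_one hQ2] at hK hphase
  obtain ⟨η, C, hη, hC, H⟩ := exists_modulation (hasDerivAt_dilateLp hQ hQc hQ2 hΛ)
    (continuousOn_inner_dilateLp hQ2 hψ hψc) hphase hscale hK
  refine ⟨η, C, hη, hC, fun v γ₀ l₀ hv hl₀ hle => ?_⟩
  have hw : MemLp (remainder Q γ₀ l₀ v) 2 radialMeasure :=
    ⟨aestronglyMeasurable_remainder hQ2 γ₀ hl₀ hv, hle.trans_lt ENNReal.ofReal_lt_top⟩
  set w := remainder Q γ₀ l₀ v with hwdef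
  have ha : MemLp (fun r => (w r).re) 2 radialMeasure := hw.re
  have hb : MemLp (fun r => (w r).im) 2 radialMeasure := hw.im
  set d := (eLpNorm w 2 radialMeasure).toReal with hd
  have hwd : eLpNorm w 2 radialMeasure = ENNReal.ofReal d :=
    (ENNReal.ofReal_toReal hw.2.ne).symm
  have hd0 : 0 ≤ d := ENNReal.toReal_nonneg
  have hdη : d ≤ η := ENNReal.toReal_le_of_le_ofReal hη.le hle
  have hnorm : ∀ μ, 0 < μ → ‖dilateLp ha μ‖ ^ 2 + ‖dilateLp hb μ‖ ^ 2 = d ^ 2 := by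
    intro μ hμ
    rw [norm_dilateLp ha hμ, norm_dilateLp hb hμ]
    have h1 := eLpNorm_sq_eq_of_re_im ha.coeFn_toLp hb.coeFn_toLp
    rw [hwd, ← ENNReal.ofReal_pow hd0,
      ENNReal.ofReal_eq_ofReal_iff (by positivity) (by positivity)] at h1
    exact h1.symm
  obtain ⟨σ, μ, hμ, ho₁, ho₂, hle', hσμ⟩ := H (dilateLp ha) (dilateLp hb) d hd0 hdη hnorm
    (continuousOn_inner_dilateLp ha hψ hψc) (continuousOn_inner_dilateLp hb hψ hψc)
  set Y₁ := Real.cos σ • (dilateLp hQ2 μ + dilateLp ha μ) - Real.sin σ • dilateLp hb μ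
    - dilateLp hQ2 1 with hY₁
  set Y₂ := Real.sin σ • (dilateLp hQ2 μ + dilateLp ha μ) + Real.cos σ • dilateLp hb μ with hY₂
  have hae : ∀ᵐ r ∂radialMeasure,
      Y₁ r = (remainder Q (γ₀ + σ) (l₀ * μ) v r).re ∧
      Y₂ r = (remainder Q (γ₀ + σ) (l₀ * μ) v r).im := by
    filter_upwards [coeFn_dilateLp hQ2 hμ, coeFn_dilateLp ha hμ, coeFn_dilateLp hb hμ,
      coeFn_dilateLp hQ2 one_pos,
      Lp.coeFn_add (dilateLp hQ2 μ) (dilateLp ha μ),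
      Lp.coeFn_smul (Real.cos σ) (dilateLp hQ2 μ + dilateLp ha μ),
      Lp.coeFn_smul (Real.sin σ) (dilateLp hQ2 μ + dilateLp ha μ),
      Lp.coeFn_smul (Real.cos σ) (dilateLp hb μ), Lp.coeFn_smul (Real.sin σ) (dilateLp hb μ),
      Lp.coeFn_sub (Real.cos σ • (dilateLp hQ2 μ + dilateLp ha μ)) (Real.sin σ • dilateLp hb μ),
      Lp.coeFn_sub (Real.cos σ • (dilateLp hQ2 μ + dilateLp ha μ) - Real.sin σ • dilateLp hb μ)
        (dilateLp hQ2 1),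
      Lp.coeFn_add (Real.sin σ • (dilateLp hQ2 μ + dilateLp ha μ)) (Real.cos σ • dilateLp hb μ)]
      with r e1 e2 e3 e4 e5 e6 e7 e8 e9 e10 e11 e12
    rw [hY₁, hY₂, e11, e12, remainder_add_mul, Complex.exp_mul_I, ← Complex.ofReal_cos,
      ← Complex.ofReal_sin]
    simp only [Pi.sub_apply, Pi.add_apply, Pi.smul_apply, e1, e2, e3, e4, e5, e6, e7, e8, e9, e10,
      smul_eq_mul]
    constructor <;> simp [-Complex.ofReal_cos, -Complex.ofReal_sin, dilate, ← hwdef] <;> ring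
  have hae₁ : Y₁ =ᵐ[radialMeasure] fun r => (remainder Q (γ₀ + σ) (l₀ * μ) v r).re :=
    hae.mono fun r h => h.1
  have hae₂ : Y₂ =ᵐ[radialMeasure] fun r => (remainder Q (γ₀ + σ) (l₀ * μ) v r).im :=
    hae.mono fun r h => h.2
  refine ⟨γ₀ + σ, l₀ * μ, mul_pos hl₀ hμ, ?_, ?_, ?_, ?_⟩
  · refine (ENNReal.pow_le_pow_left_iff two_ne_zero).1 ?_
    rw [eLpNorm_sq_eq_of_re_im hae₁ hae₂, hwd, ← ENNReal.ofReal_mul hK0,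
      ← ENNReal.ofReal_pow (by positivity)]
    exact ENNReal.ofReal_le_ofReal hle'
  · rw [l2Inner_toC_right, ← inner_toLp_right hae₁ hψ, ho₁]
  · rw [l2Inner_I_mul_toC_right, ← inner_toLp_right hae₂ hψ, ho₂]
  · rw [hwd, ← ENNReal.ofReal_mul hC.le, add_sub_cancel_left, mul_div_cancel_left₀ _ hl₀.ne']
    exact ENNReal.ofReal_le_ofReal hσμ

end CSS

theorem theorem4p1 (m : ℕ) (g α : ℝ) (hg : 1 < g) (hα : 0 < α) (Q ψ : ℝ → ℝ)
    (hQ : CSS.IsSoliton m g α Q)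
    (hψ : CSS.IsNegEigenfunction m g Q ψ)
    (hscale : CSS.l2Inner (CSS.toC (CSS.scalingGen Q)) (CSS.toC ψ) ≠ 0)
    (hphase : CSS.l2Inner (CSS.toC Q) (CSS.toC ψ) ≠ 0)
    (K : ℝ)
    (hK : max
        (CSS.l2Norm Q * CSS.l2Norm ψ / |CSS.l2Inner (CSS.toC Q) (CSS.toC ψ)|)
        (CSS.l2Norm (CSS.scalingGen Q) * CSS.l2Norm ψ /
          |CSS.l2Inner (CSS.toC (CSS.scalingGen Q)) (CSS.toC ψ)|) < K) :
    ∃ η C : ℝ, 0 < η ∧ 0 < C ∧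
      ∀ η₀ : ℝ, 0 < η₀ → η₀ ≤ η →
      ∀ (I : Set ℝ) (u : ℝ → ℝ → ℂ),
        (∀ t ∈ I, MeasureTheory.MemLp (u t) 2 CSS.radialMeasure) →
      ∀ γ₀ l₀ : ℝ → ℝ,
        (∀ t ∈ I, 0 < l₀ t ∧
          MeasureTheory.eLpNorm (CSS.remainder Q (γ₀ t) (l₀ t) (u t)) 2 CSS.radialMeasure
            ≤ ENNReal.ofReal η₀) →
        ∃ γ l : ℝ → ℝ, ∀ t ∈ I,
          0 < l t ∧
          MeasureTheory.eLpNorm (CSS.remainder Q (γ t) (l t) (u t)) 2 CSS.radialMeasure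
            ≤ ENNReal.ofReal (K * η₀) ∧
          CSS.l2Inner (CSS.remainder Q (γ t) (l t) (u t)) (CSS.toC ψ) = 0 ∧
          CSS.l2Inner (CSS.remainder Q (γ t) (l t) (u t))
            (fun r => Complex.I * CSS.toC ψ r) = 0 ∧
          ENNReal.ofReal (|γ t - γ₀ t| + |l t / l₀ t - 1|) ≤
            ENNReal.ofReal C *
              (MeasureTheory.eLpNorm (CSS.remainder Q (γ₀ t) (l₀ t) (u t)) 2 CSS.radialMeasure
                + MeasureTheory.eLpNorm (CSS.remainder Q (γ₀ t) (l₀ t) (u t)) 2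
                    CSS.radialMeasure
                  * MeasureTheory.eLpNorm (CSS.remainder Q (γ₀ t) (l₀ t) (u t)) 4
                    CSS.radialMeasure ^ 2) := by
  obtain ⟨η, C, hη, hC, H⟩ := CSS.exists_modulation_of_remainder_le hQ.memH1.differentiableOn
    hQ.continuousOn_scalingGen hQ.memH1.memLp (hQ.memLp_scalingGen hα) hψ.memH1.memLp
    hψ.memH1.differentiableOn.continuousOn hscale hphase hK
  have hK0 : 0 ≤ K := le_trans (le_max_of_le_left
    (div_nonneg (mul_nonneg ENNReal.toReal_nonneg ENNReal.toReal_nonneg) (abs_nonneg _))) hK.le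
  refine ⟨η, C, hη, hC, fun η₀ _ hη₀ I u hu γ₀ l₀ h₀ => ?_⟩
  have key := fun t (ht : t ∈ I) => H (u t) (γ₀ t) (l₀ t) (hu t ht) (h₀ t ht).1
    ((h₀ t ht).2.trans (ENNReal.ofReal_le_ofReal hη₀))
  choose! γ l hl hle ho₁ ho₂ hbound using key
  refine ⟨γ, l, fun t ht => ⟨hl t ht, (hle t ht).trans ?_, ho₁ t ht, ho₂ t ht,
    (hbound t ht).trans (mul_le_mul_right le_self_add _)⟩⟩
  rw [ENNReal.ofReal_mul hK0]
  exact mul_le_mul_right (h₀ t ht).2 _
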